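/- Let $N$ be a lattice of rank $n$ with dual lattice $M=\operatorname{Hom}(N,\mathbb Z)$, let $N_{\mathbb R}=N\otimes\mathbb R$ and $M_{\mathbb R}=M\otimes\mathbb R=N_{\mathbb R}^{*}$, and let $\operatorname{vol}_M$ be the Haar measure on $M_{\mathbb R}$ for which a fundamental domain of $M$ has volume $1$. A *rational polytope* in $M_{\mathbb R}$ is a bounded set that is a finite intersection of half-spaces $\{x:\langle x,u\rangle+c\ge 0\}$ with $u\in N$, $c\in\mathbb R$. A function $f:N_{\mathbb R}\to\mathbb R\cup\{-\infty\}$ is *concave* if it is not identically $-\infty$ and $f(tu_1+(1-t)u_2)\ge tf(u_1)+(1-t)f(u_2)$ for all $u_1,u_2\in N_{\mathbb R}$, $t\in[0,1]$. Its Legendre-Fenchel dual is $f^\vee(x)=\inf_{u\in N_{\mathbb R}}(\langle x,u\rangle-f(u))$ for $x\in M_{\mathbb R}$, and its *stability set* is $\operatorname{dom}(f^\vee)=\{x: f^\vee(x)\neq-\infty\}$. For $B\subseteq M_{\mathbb R}$ the indicator function $\iota_B$ is $0$ on $B$ and $-\infty$ elsewhere. For functions $g_0,\dots,g_n$ on $M_{\mathbb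 R}$ with effective domains $B_0,\dots,B_n$, the *mixed integral* is $$\operatorname{MI}_M(g_0,\dots,g_n)=\sum_{k=0}^n(-1)^{n-k}\sum_{0\le i_0<\dots<i_k\le n}\int_{B_{i_0}+\dots+B_{i_k}}(g_{i_0}\boxplus\dots\boxplus g_{i_k})\,d\operatorname{vol}_M,$$ where $(g_{i_0}\boxplus\dots\boxplus g_{i_k})(x)=\sup\{g_{i_0}(y_0)+\dots+g_{i_k}(y_k):y_0+\dots+y_k=x\}$. The *mixed volume* of $Q_1,\dots,Q_n\subseteq M_{\mathbb R}$ is $$\operatorname{MV}_M(Q_1,\dots,Q_n)=\sum_{S\subseteq\{1,\dots,n\}}(-1)^{n-|S|}\operatorname{vol}_M\Big(\sum_{i\in S}Q_i\Big),$$ the empty Minkowski sum being $\{0\}$ (which contributes $0$ when $n\ge1$), so that $\operatorname{MV}_M(Q,\dots,Q)=n!\operatorname{vol}_M(Q)$ for every nonempty compact convex $Q$. **Corollary.** Let $Q_1,\dots,Q_n$ be nonempty rational polytopes in $M_{\mathbb R}$ and let $f$ be a concave function on $N_{\mathbb R}$ whose stability set is a rational polytope. Then $f(0)$ is finite and $$\operatorname{MI}_M(\iota_{Q_1},\dots,\iota_{Q_n},f^\vee)=-\operatorname{MV}_M(Q_1,\dots,Q_n)\cdot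 f(0).$$ -/

import Mathlib

open scoped Pointwise

namespace MixedIntegral

section Lattices

variable {V : Type*} [NormedAddCommGroup V] [NormedSpace ℝ V]

/-- The dual lattice `M = Hom(N, ℤ)` of a lattice `N` in `N_ℝ = V`, as a subgroup of the dual
space `M_ℝ = V*`: the linear forms on `N_ℝ` that take integral values on `N`. -/
def dualLattice (N : Submodule ℤ V) : Submodule ℤ (StrongDual ℝ V) where
  carrier := {x | ∀ u ∈ N, ∃ k : ℤ, x u = k}
  add_mem' := by
    intro x y hx hy u hu
    obtain ⟨a, ha⟩ := hx u hu
    obtain ⟨b, hb⟩ := hy u hu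
    exact ⟨a + b, by simp [ha, hb]⟩
  zero_mem' := fun u _ => ⟨0, by simp⟩
  smul_mem' := by
    intro c x hx u hu
    obtain ⟨a, ha⟩ := hx u hu
    exact ⟨c * a, by simp [ha]⟩

/-- A rational polyhedron in `M_ℝ`: a finite intersection of closed half-spaces
`{x | ⟨x, u⟩ + c ≥ 0}` with slopes `u ∈ N` and arbitrary real constants `c`. -/
def IsRationalPolyhedron (N : Submodule ℤ V) (P : Set (StrongDual ℝ V)) : Prop :=
  ∃ (k : ℕ) (u : Fin k → N) (c : Fin k → ℝ), P = {x | ∀ j, 0 ≤ x (u j : V) + c j}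

/-- A rational polytope in `M_ℝ`: a bounded rational polyhedron. -/
def IsRationalPolytope (N : Submodule ℤ V) (P : Set (StrongDual ℝ V)) : Prop :=
  IsRationalPolyhedron N P ∧ Bornology.IsBounded P

variable [FiniteDimensional ℝ V]

open Classical in
/-- The basis of `M_ℝ` dual to a chosen `ℤ`-basis of `N`. -/
noncomputable def dualLatticeBasis (N : Submodule ℤ V) [DiscreteTopology N] [IsZLattice ℝ N] :
    Module.Basis (Module.Free.ChooseBasisIndex ℤ N) ℝ (StrongDual ℝ V) :=
  (((Module.Free.chooseBasis ℤ N).ofZLatticeBasis ℝ N).dualBasis).map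
    LinearMap.toContinuousLinearMap

/-- The dual basis of a `ℤ`-basis of `N` is a `ℤ`-basis of the dual lattice `M`. -/
theorem span_dualLatticeBasis (N : Submodule ℤ V) [DiscreteTopology N] [IsZLattice ℝ N] :
    Submodule.span ℤ (Set.range (dualLatticeBasis N)) = dualLattice N := by
  classical
  have key : ∀ i j, dualLatticeBasis N i (Module.Free.chooseBasis ℤ N j : V) =
      if j = i then 1 else 0 := by
    intro i j
    have h := Module.Basis.dualBasis_apply_self
      ((Module.Free.chooseBasis ℤ N).ofZLatticeBasis ℝ N) i j
    rw [Module.Basis.ofZLatticeBasis_apply] at h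
    simp only [dualLatticeBasis, Module.Basis.map_apply]
    exact h
  apply le_antisymm
  · rw [Submodule.span_le]
    rintro _ ⟨i, rfl⟩ u hu
    refine ⟨(Module.Free.chooseBasis ℤ N).repr ⟨u, hu⟩ i, ?_⟩
    have h : u = ∑ j, (Module.Free.chooseBasis ℤ N).repr ⟨u, hu⟩ j •
        (Module.Free.chooseBasis ℤ N j : V) := by
      have h0 := congrArg Subtype.val ((Module.Free.chooseBasis ℤ N).sum_repr ⟨u, hu⟩)
      push_cast at h0
      exact h0.symm
    have h2 := congrArg (dualLatticeBasis N i) h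
    rw [h2, map_sum]
    simp [key]
  · intro x hx
    choose k hk using fun j => hx _ (Module.Free.chooseBasis ℤ N j).2
    have hxs : x = ∑ j, k j • dualLatticeBasis N j := by
      apply ContinuousLinearMap.coe_injective
      apply ((Module.Free.chooseBasis ℤ N).ofZLatticeBasis ℝ N).ext
      intro j
      rw [Module.Basis.ofZLatticeBasis_apply]
      simp [key, hk]
    rw [hxs]
    exact Submodule.sum_mem _ fun j _ =>
      Submodule.smul_mem _ _ (Submodule.subset_span ⟨j, rfl⟩)

/-- The Haar measure `vol_M` on `M_ℝ` for which the fundamental domains of `M` have volume `1`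
(the parallelepiped spanned by a basis of `M` is one of them). -/
noncomputable def latticeVolume (N : Submodule ℤ V) [DiscreteTopology N] [IsZLattice ℝ N] :
    MeasureTheory.Measure (StrongDual ℝ V) :=
  (dualLatticeBasis N).addHaar

/-- `vol_M` gives measure `1` to the fundamental parallelepiped of `M` spanned by a `ℤ`-basis. -/
theorem latticeVolume_fundamentalDomain (N : Submodule ℤ V) [DiscreteTopology N]
    [IsZLattice ℝ N] :
    latticeVolume N (ZSpan.fundamentalDomain (dualLatticeBasis N)) = 1 := by
  rw [latticeVolume, MeasureTheory.measure_congr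
    (ZSpan.fundamentalDomain_ae_parallelepiped (dualLatticeBasis N) _)]
  exact (dualLatticeBasis N).addHaar_self

end Lattices

section Concave

variable {V : Type*} [NormedAddCommGroup V] [NormedSpace ℝ V]

/-- Concave functions `f : N_ℝ → ℝ ∪ {-∞}`, not identically `-∞`. -/
structure IsConcave (f : V → EReal) : Prop where
  ne_top : ∀ u, f u ≠ ⊤
  exists_ne_bot : ∃ u, f u ≠ ⊥
  concave : ∀ u v : V, ∀ t : ℝ, 0 ≤ t → t ≤ 1 →
    (t : EReal) * f u + ((1 - t : ℝ) : EReal) * f v ≤ f (t • u + (1 - t) • v)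

/-- The effective domain of a function with values in `ℝ ∪ {-∞}`. -/
def effectiveDomain {E : Type*} (g : E → EReal) : Set E :=
  {x | g x ≠ ⊥}

/-- The Legendre-Fenchel dual `f^∨(x) = inf_u (⟨x, u⟩ - f(u))`, a function on `M_ℝ`. -/
noncomputable def legendreDual (f : V → EReal) (x : StrongDual ℝ V) : EReal :=
  ⨅ u : V, ((x u : ℝ) : EReal) - f u

/-- The stability set of `f`: the effective domain of its Legendre-Fenchel dual. -/
def stabilitySet (f : V → EReal) : Set (StrongDual ℝ V) :=
  effectiveDomain (legendreDual f)

open Classical in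
/-- The indicator function `ι_B` of a set: `0` on `B` and `-∞` elsewhere. -/
noncomputable def indicatorFn {E : Type*} (B : Set E) (x : E) : EReal :=
  if x ∈ B then 0 else ⊥

end Concave

section Mixed

variable {E : Type*} [AddCommGroup E]

/-- The sup-convolution of the functions `g i`, `i ∈ S`:
`x ↦ sup {∑ i ∈ S, g i (y i) | ∑ i ∈ S, y i = x}`. -/
noncomputable def supConvolution {ι : Type*} (S : Finset ι) (g : ι → E → EReal) (x : E) :
    EReal :=
  ⨆ (y : ι → E) (_ : ∑ i ∈ S, y i = x), ∑ i ∈ S, g i (y i)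

variable [MeasurableSpace E]

/-- The mixed volume of `Q_1, …, Q_n` in an `n`-dimensional space, given by polarization and
normalized so that `MV_μ(Q, …, Q) = n! μ(Q)`. The sum is over all sets `S` of indices; for
`S = ∅` the Minkowski sum is `{0}`, which has measure zero as soon as `n ≥ 1`. -/
noncomputable def mixedVolume (μ : MeasureTheory.Measure E) {n : ℕ} (Q : Fin n → Set E) : ℝ :=
  ∑ S : Finset (Fin n), (-1 : ℝ) ^ (n - S.card) * μ.real (∑ i ∈ S, Q i)

/-- The mixed integral `MI_μ(g_0, …, g_n)`: the sum over the nonempty subsets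
`S = {i_0 < … < i_k}` of `{0, …, n}` of `(-1)^(n-k)` times the integral of the sup-convolution
of the `g i`, `i ∈ S`, over the Minkowski sum of their effective domains. -/
noncomputable def mixedIntegral (μ : MeasureTheory.Measure E) {n : ℕ}
    (g : Fin (n + 1) → E → EReal) : ℝ :=
  ∑ S : Finset (Fin (n + 1)) with S.Nonempty, (-1 : ℝ) ^ (n + 1 - S.card) *
    ∫ x in ∑ i ∈ S, effectiveDomain (g i), (supConvolution S g x).toReal ∂μ

end Mixed

end MixedIntegral

/-! Write `g` for the Legendre dual, `m` for a lower bound of `g` on its domain and `M` for its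
maximum. In the mixed integral, the index sets that omit `g` contribute zero, since their
sup-convolutions only take the values `0` and `⊥`. For the others, a strict superlevel set of the
sup-convolution of the `ι_{Q_i}`, `i ∈ T`, with `g` is the Minkowski sum of `Q_T = ∑ i ∈ T, Q i` and
the superlevel set of `g`. The layer cake formula (`integral_eq_of_superlevel`) therefore turns each
integral into `m vol(Q_T + dom g)` plus the integral over `0 < t < M - m` of `vol(Q_T + {g > m +
t})`.

The alternating sum over `T` of `vol(Q_T + K)` equals the mixed volume for every nonempty bounded
convex `K` (`sum_neg_one_pow_mul_volume_sum_add`). So the total is `MV * (m + (M - m)) = MV * M`.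
Finally `M = -f 0`: the bound comes from `u = 0` in the infimum, and it is attained at a
supergradient of `f` at `0`. The supergradient exists because a bounded stability set forces `f` to
be finite everywhere.

Independence of `K` says that the alternating sum of volumes of partial Minkowski sums of `n + 1`
convex sets in dimension `n` vanishes. For hulls of finite sets, volume is the integral of the
Hessian determinant of a log-sum-exp potential, whose gradient maps the space bijectively onto a set
between the interior and the body. Potentials add under Minkowski sums, so the claim reduces
pointwise to a polarization identity: the determinant has degree `n`, and its alternating sum over
subsets of `n + 1` matrices is zero. General bounded convex sets follow by approximation. -/

namespace MixedIntegral

/-! ### Volume of a convex body as a Monge-Ampère integral -/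

section Potentials

open scoped RealInnerProductSpace
open MeasureTheory

/-- A convex set with empty interior lies in a hyperplane. -/
theorem exists_dual_ne_zero_of_interior_eq_empty {E : Type*} [NormedAddCommGroup E]
    [NormedSpace ℝ E] [FiniteDimensional ℝ E] {C : Set E} (hC : Convex ℝ C) (hne : C.Nonempty)
    (hint : interior C = ∅) :
    ∃ φ : StrongDual ℝ E, φ ≠ 0 ∧ ∀ x ∈ C, ∀ y ∈ C, φ x = φ y := by
  have h1 : affineSpan ℝ C ≠ ⊤ := fun h => by
    have := hC.interior_nonempty_iff_affineSpan_eq_top.2 h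
    simp [hint] at this
  have h2 : vectorSpan ℝ C < ⊤ := by
    rw [lt_top_iff_ne_top]
    intro h
    exact h1 ((AffineSubspace.affineSpan_eq_top_iff_vectorSpan_eq_top_of_nonempty ℝ E E hne).2 h)
  obtain ⟨φ, hφ0, hφ⟩ := Submodule.exists_le_ker_of_lt_top _ h2
  refine ⟨LinearMap.toContinuousLinearMap φ, by simpa using hφ0, fun x hx y hy => ?_⟩
  have h3 : φ (x -ᵥ y) = 0 := hφ (vsub_mem_vectorSpan ℝ hx hy)
  rw [vsub_eq_sub, map_sub, sub_eq_zero] at h3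
  simpa using h3

variable {E : Type*} [NormedAddCommGroup E] [InnerProductSpace ℝ E]

/-- A smooth convex function `φ` with gradient `G` and Hessian `H`, bounded below by the support
function of `K`, whose gradient takes values in `K`, and whose Hessian degenerates only in the
directions on which `K` is constant. -/
structure IsPotential (K : Set E) (φ : E → ℝ) (G : E → E) (H : E → E →L[ℝ] E) : Prop where
  grad : ∀ x, HasFDerivAt φ (innerSL ℝ (G x)) x
  hess : ∀ x, HasFDerivAt G (H x) x
  pos : ∀ x, (H x).IsPositive
  mem : ∀ x, G x ∈ K
  le : ∀ x, ∀ k ∈ K, ⟪k, x⟫ ≤ φ x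
  deg : ∀ x v, ⟪H x v, v⟫ = 0 → ∀ k ∈ K, ∀ l ∈ K, ⟪k, v⟫ = ⟪l, v⟫

theorem IsPotential.zero : IsPotential (0 : Set E) (fun _ => 0) (fun _ => 0) (fun _ => 0) where
  grad x := by simpa using hasFDerivAt_const (0 : ℝ) x
  hess x := hasFDerivAt_const 0 x
  pos x := ContinuousLinearMap.isPositive_zero
  mem x := by simp
  le x k hk := by
    rw [Set.mem_zero] at hk
    simp [hk]
  deg x v _ k hk l hl := by
    rw [Set.mem_zero] at hk hl
    simp [hk, hl]

/-- This additivity is the reason for using potentials: Minkowski addition of bodies becomes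
addition of Hessians. For `deg`, both quadratic forms are nonnegative, so if their sum vanishes then
each does. -/
theorem IsPotential.add {K L : Set E} {φ ψ : E → ℝ} {G F : E → E} {H I : E → E →L[ℝ] E}
    (h : IsPotential K φ G H) (h' : IsPotential L ψ F I) :
    IsPotential (K + L) (fun x => φ x + ψ x) (fun x => G x + F x) (fun x => H x + I x) where
  grad x := by
    rw [map_add]
    exact (h.grad x).add (h'.grad x)
  hess x := (h.hess x).add (h'.hess x)
  pos x := (h.pos x).add (h'.pos x)
  mem x := Set.add_mem_add (h.mem x) (h'.mem x)
  le x k hk := by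
    obtain ⟨a, ha, b, hb, rfl⟩ := hk
    rw [inner_add_left]
    exact add_le_add (h.le x a ha) (h'.le x b hb)
  deg x v hv k hk l hl := by
    obtain ⟨a, ha, b, hb, rfl⟩ := hk
    obtain ⟨c, hc, d, hd, rfl⟩ := hl
    have h1 : 0 ≤ ⟪H x v, v⟫ := (h.pos x).inner_nonneg_left v
    have h2 : 0 ≤ ⟪I x v, v⟫ := (h'.pos x).inner_nonneg_left v
    rw [add_apply, inner_add_left] at hv
    simp only [inner_add_left]
    rw [h.deg x v (by linarith) a ha c hc, h'.deg x v (by linarith) b hb d hd]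

theorem IsPotential.sum {ι : Type*} (S : Finset ι) {K : ι → Set E} {φ : ι → E → ℝ}
    {G : ι → E → E} {H : ι → E → E →L[ℝ] E} (h : ∀ i ∈ S, IsPotential (K i) (φ i) (G i) (H i)) :
    IsPotential (∑ i ∈ S, K i) (fun x => ∑ i ∈ S, φ i x) (fun x => ∑ i ∈ S, G i x)
      (fun x => ∑ i ∈ S, H i x) := by
  classical
  induction S using Finset.induction_on with
  | empty => simpa using IsPotential.zero
  | insert i S hi ih =>
    simp only [Finset.sum_insert hi]
    exact (h i (by simp)).add (ih fun j hj => h j (by simp [hj]))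

/-- The convex hull of a finite set has a potential: the logarithm of a sum of exponentials. -/
theorem exists_isPotential_convexHull (s : Finset E) (hs : s.Nonempty) :
    ∃ φ G H, IsPotential (convexHull ℝ (s : Set E)) φ G H := by
  set e : E → E → ℝ := fun a x => Real.exp ⟪a, x⟫ with he
  set Z : E → ℝ := fun x => ∑ a ∈ s, e a x with hZ
  have hepos : ∀ a x, 0 < e a x := fun a x => Real.exp_pos _
  have hZpos : ∀ x, 0 < Z x := fun x => Finset.sum_pos (fun a _ => hepos a x) hs
  set A : E → E := fun x => ∑ a ∈ s, e a x • a with hA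
  set G : E → E := fun x => (Z x)⁻¹ • A x with hG
  -- With the probability weights `e a x / Z x` on `s`, `G x` is the mean and `H x` the covariance
  -- operator.
  set H : E → E →L[ℝ] E := fun x =>
    (Z x)⁻¹ • (∑ a ∈ s, (e a x • innerSL ℝ a).smulRight a) - (innerSL ℝ (G x)).smulRight (G x)
    with hH
  have hde : ∀ a x, HasFDerivAt (e a) (e a x • innerSL ℝ a) x := fun a x =>
    ((innerSL ℝ a).hasFDerivAt (x := x)).exp
  have hdZ : ∀ x, HasFDerivAt Z (∑ a ∈ s, e a x • innerSL ℝ a) x := fun x =>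
    HasFDerivAt.fun_sum fun a _ => hde a x
  have hdA : ∀ x, HasFDerivAt A (∑ a ∈ s, (e a x • innerSL ℝ a).smulRight a) x := fun x =>
    HasFDerivAt.fun_sum fun a _ => (hde a x).smul_const a
  have hZA : ∀ x, ∑ a ∈ s, e a x • innerSL ℝ a = innerSL ℝ (A x) := fun x => by
    simp [hA, map_sum]
  have hAG : ∀ x, A x = Z x • G x := fun x => by
    simp [hG, smul_smul, (hZpos x).ne']
  have hHap : ∀ x v w, ⟪H x v, w⟫ =
      (Z x)⁻¹ * ∑ a ∈ s, e a x * ⟪a, v⟫ * ⟪a, w⟫ - ⟪G x, v⟫ * ⟪G x, w⟫ := by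
    intro x v w
    simp [hH, inner_sub_left, inner_smul_left, sum_inner]
  have hGap : ∀ x v, ∑ a ∈ s, e a x * ⟪a, v⟫ = Z x * ⟪G x, v⟫ := by
    intro x v
    rw [← real_inner_smul_left, ← hAG, hA, sum_inner]
    simp [inner_smul_left]
  -- The quadratic form of `H x` is the variance of `⟪a, v⟫`: nonnegative, and zero only if `⟪·, v⟫`
  -- is constant on `s`.
  have hHsq : ∀ x v, ⟪H x v, v⟫ = (Z x)⁻¹ * ∑ a ∈ s, e a x * (⟪a, v⟫ - ⟪G x, v⟫) ^ 2 := by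
    intro x v
    have h1 : ∑ a ∈ s, e a x * (⟪a, v⟫ - ⟪G x, v⟫) ^ 2 =
        ∑ a ∈ s, e a x * ⟪a, v⟫ * ⟪a, v⟫ - 2 * ⟪G x, v⟫ * ∑ a ∈ s, e a x * ⟪a, v⟫ +
          ⟪G x, v⟫ ^ 2 * ∑ a ∈ s, e a x := by
      rw [Finset.mul_sum, Finset.mul_sum, ← Finset.sum_sub_distrib, ← Finset.sum_add_distrib]
      exact Finset.sum_congr rfl fun a _ => by ring
    rw [hHap, h1, hGap]
    change _ = (Z x)⁻¹ * (_ - _ + ⟪G x, v⟫ ^ 2 * Z x)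
    have := (hZpos x).ne'
    field_simp
    ring
  refine ⟨fun x => Real.log (Z x), G, H, ?_, ?_, ?_, ?_, ?_, ?_⟩
  · intro x
    have := (hdZ x).log (hZpos x).ne'
    rw [hZA] at this
    simpa [hG] using this
  · intro x
    have h1 := ((hasDerivAt_inv (hZpos x).ne').comp_hasFDerivAt x (hdZ x)).smul (hdA x)
    refine h1.congr_fderiv ?_
    ext v
    rw [hZA, hAG]
    have := (hZpos x).ne'
    simp only [hH, add_apply,
      smul_apply, ContinuousLinearMap.smulRight_apply, innerSL_apply_apply,
      Function.comp, sub_eq_add_neg, inner_smul_left, smul_smul, smul_eq_mul]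
    congr 2
    simp
    field_simp
  · intro x
    rw [ContinuousLinearMap.isPositive_iff]
    refine ⟨fun v w => ?_, fun v => ?_⟩
    · change ⟪H x v, w⟫ = ⟪v, H x w⟫
      rw [real_inner_comm (H x w), hHap, hHap]
      congr 1
      · congr 1
        exact Finset.sum_congr rfl fun a _ => by ring
      · ring
    · rw [hHsq]
      exact mul_nonneg (inv_nonneg.2 (hZpos x).le) (Finset.sum_nonneg fun a _ =>
        mul_nonneg (hepos a x).le (sq_nonneg _))
  · intro x
    have h1 : G x = ∑ a ∈ s, ((Z x)⁻¹ * e a x) • a := by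
      simp [hG, hA, Finset.smul_sum, smul_smul]
    rw [h1]
    refine (convex_convexHull ℝ _).sum_mem (fun a _ => ?_) ?_ fun a ha =>
      subset_convexHull ℝ _ ha
    · exact mul_nonneg (inv_nonneg.2 (hZpos x).le) (hepos a x).le
    · rw [← Finset.mul_sum]
      exact inv_mul_cancel₀ (hZpos x).ne'
  · intro x k hk
    have h1 : convexHull ℝ (s : Set E) ⊆ {k | ⟪k, x⟫ ≤ Real.log (Z x)} := by
      refine convexHull_min (fun a ha => ?_) ?_
      · rw [Set.mem_ofPred_eq, Real.le_log_iff_exp_le (hZpos x)]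
        exact Finset.single_le_sum (f := fun a => e a x) (fun b _ => (hepos b x).le) ha
      · exact convex_halfSpace_le ⟨fun a b => inner_add_left _ _ _,
          fun c a => by simp [inner_smul_left]⟩ _
    exact h1 hk
  · intro x v hv
    rw [hHsq, mul_eq_zero, inv_eq_zero, or_iff_right (hZpos x).ne',
      Finset.sum_eq_zero_iff_of_nonneg fun a _ =>
        mul_nonneg (hepos a x).le (sq_nonneg _)] at hv
    have h1 : convexHull ℝ (s : Set E) ⊆ {k | ⟪k, v⟫ = ⟪G x, v⟫} := by
      refine convexHull_min (fun a ha => ?_) ?_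
      · have := hv a ha
        rw [mul_eq_zero, or_iff_right (hepos a x).ne', sq_eq_zero_iff, sub_eq_zero] at this
        exact this
      · exact convex_hyperplane ⟨fun a b => inner_add_left _ _ _,
          fun c a => by simp [inner_smul_left]⟩ _
    intro k hk l hl
    rw [h1 hk, h1 hl]

/-- Along the segment from `x` in direction `v = y - x`, `⟪G, v⟫` has derivative `⟪H v, v⟫`. This is
positive, since by `deg` a zero would make `⟪·, v⟫` constant on `K`, which fails near an interior
point. So `⟪G, v⟫` differs at the two ends. -/
theorem IsPotential.gradient_injective {K : Set E} {φ : E → ℝ} {G : E → E}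
    {H : E → E →L[ℝ] E} (h : IsPotential K φ G H) (hK : (interior K).Nonempty) :
    Function.Injective G := by
  intro x y hxy
  by_contra hne
  set v := y - x with hv
  have hv0 : v ≠ 0 := sub_ne_zero.2 (Ne.symm hne)
  have hpos : ∀ z, 0 < ⟪H z v, v⟫ := by
    intro z
    refine lt_of_le_of_ne ((h.pos z).inner_nonneg_left v) fun h0 => hv0 ?_
    have hc := h.deg z v h0.symm
    obtain ⟨k, hk⟩ := hK
    have h1 : ∀ᶠ t : ℝ in nhdsWithin 0 (Set.Ioi 0), k + t • v ∈ K := by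
      have hcont : Filter.Tendsto (fun t : ℝ => k + t • v) (nhds 0) (nhds k) := by
        have : Continuous fun t : ℝ => k + t • v := by fun_prop
        simpa using this.tendsto 0
      exact (hcont.eventually (mem_interior_iff_mem_nhds.1 hk)).filter_mono nhdsWithin_le_nhds
    obtain ⟨t, ht, ht0⟩ := (h1.and self_mem_nhdsWithin).exists
    have h2 := hc _ ht _ (interior_subset hk)
    rw [inner_add_left, real_inner_smul_left] at h2
    have h3 : t * ⟪v, v⟫ = 0 := by linarith
    rw [mul_eq_zero, or_iff_right (ne_of_gt ht0)] at h3
    simpa using h3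
  have hd : ∀ t : ℝ, HasDerivAt (fun t : ℝ => ⟪G (x + t • v), v⟫) ⟪H (x + t • v) v, v⟫ t := by
    intro t
    have h1 : HasDerivAt (fun t : ℝ => x + t • v) v t := by
      simpa using ((hasDerivAt_id t).smul_const v).const_add x
    have h2 := ((h.hess (x + t • v)).comp_hasDerivAt t h1).inner ℝ (hasDerivAt_const t v)
    simpa using h2
  have hmono : StrictMono (fun t : ℝ => ⟪G (x + t • v), v⟫) :=
    strictMono_of_deriv_pos fun t => by
      rw [(hd t).deriv]
      exact hpos _
  have h01 := hmono zero_lt_one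
  simp [hv, hxy] at h01

variable [FiniteDimensional ℝ E]

theorem det_nonneg_of_isPositive {T : E →L[ℝ] E} (hT : T.IsPositive) : 0 ≤ T.det := by
  have h := (stdOrthonormalBasis ℝ E)
  have h1 := (LinearMap.posSemidef_toMatrix_iff (A := (T : E →ₗ[ℝ] E)) h).2 hT
  have h2 := h1.det_nonneg
  rwa [LinearMap.det_toMatrix] at h2

/-- For `p` interior to `K`, the function `φ - ⟪p, ·⟫` is coercive because `φ` dominates the support
function of a ball around `p`. It attains its minimum, and there `G = p`. -/
theorem IsPotential.interior_subset_range {K : Set E} {φ : E → ℝ} {G : E → E}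
    {H : E → E →L[ℝ] E} (h : IsPotential K φ G H) : interior K ⊆ Set.range G := by
  intro p hp
  obtain ⟨ε, hε, hball⟩ := Metric.mem_nhds_iff.1 (mem_interior_iff_mem_nhds.1 hp)
  have hcoer : ∀ x, (ε / 2) * ‖x‖ ≤ φ x - ⟪p, x⟫ := by
    intro x
    rcases eq_or_ne x 0 with rfl | hx
    · have := h.le 0 _ (h.mem 0)
      simpa using this
    · have hx' : 0 < ‖x‖ := norm_pos_iff.2 hx
      have hk : p + (ε / 2 / ‖x‖) • x ∈ K := by
        apply hball
        rw [Metric.mem_ball, dist_eq_norm, add_sub_cancel_left, norm_smul, Real.norm_of_nonneg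
          (by positivity), div_mul_cancel₀ _ hx'.ne']
        linarith
      have h1 := h.le x _ hk
      rw [inner_add_left, real_inner_smul_left, real_inner_self_eq_norm_sq] at h1
      have h2 : ε / 2 / ‖x‖ * ‖x‖ ^ 2 = ε / 2 * ‖x‖ := by field_simp
      linarith
  have hd : ∀ x, HasFDerivAt (fun x => φ x - ⟪p, x⟫) (innerSL ℝ (G x) - innerSL ℝ p) x :=
    fun x => (h.grad x).sub (innerSL ℝ p).hasFDerivAt
  have hcont : Continuous fun x => φ x - ⟪p, x⟫ :=
    continuous_iff_continuousAt.2 fun x => (hd x).continuousAt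
  have htend : Filter.Tendsto (fun x => φ x - ⟪p, x⟫) (Filter.cocompact E) Filter.atTop :=
    Filter.tendsto_atTop_mono hcoer
      ((tendsto_norm_cocompact_atTop (E := E)).const_mul_atTop (by positivity))
  obtain ⟨x, hx⟩ := hcont.exists_forall_le htend
  have h0 := IsLocalMin.hasFDerivAt_eq_zero (Filter.Eventually.of_forall hx) (hd x)
  rw [← map_sub] at h0
  refine ⟨x, ?_⟩
  rw [← sub_eq_zero, ← inner_self_eq_zero (𝕜 := ℝ)]
  exact congrArg (fun L : E →L[ℝ] ℝ => L (G x - p)) h0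

variable [MeasurableSpace E] [BorelSpace E] (μ : Measure E) [μ.IsAddHaarMeasure]

/-- The volume of a convex body is the integral of the Monge-Ampère density of a potential. -/
theorem IsPotential.integral_det {K : Set E} {φ : E → ℝ} {G : E → E}
    {H : E → E →L[ℝ] E} (h : IsPotential K φ G H) (hK : Convex ℝ K)
    (hb : Bornology.IsBounded K) :
    Integrable (fun x => (H x).det) μ ∧ ∫ x, (H x).det ∂μ = μ.real K := by
  -- If `K` lies in a hyperplane, both sides are zero; otherwise `G` is an injective change of
  -- variables.
  rcases (interior K).eq_empty_or_nonempty with hint | hint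
  · obtain ⟨ψ, hψ0, hψ⟩ := exists_dual_ne_zero_of_interior_eq_empty hK ⟨_, h.mem 0⟩ hint
    obtain ⟨v, rfl⟩ := (InnerProductSpace.toDual ℝ E).surjective ψ
    have hv0 : v ≠ 0 := by
      rintro rfl
      simp at hψ0
    have hdet : ∀ x, (H x).det = 0 := by
      intro x
      have h1 : HasFDerivAt (fun x => ⟪v, G x⟫) ((innerSL ℝ v).comp (H x)) x :=
        (innerSL ℝ v).hasFDerivAt.comp x (h.hess x)
      have h2 : (fun x => ⟪v, G x⟫) = fun _ => ⟪v, G 0⟫ := by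
        funext y
        exact hψ _ (h.mem y) _ (h.mem 0)
      rw [h2] at h1
      have h3 := h1.unique (hasFDerivAt_const _ _)
      -- `⟪v, G⟫` is constant, so `⟪v, H x w⟫ = 0` for all `w`; take `w = H x v` and use the
      -- symmetry of `H x`.
      have h4 : H x v = 0 := by
        have h5 := congrArg (fun L : E →L[ℝ] ℝ => L (H x v)) h3
        have h6 : ⟪v, H x (H x v)⟫ = 0 := h5
        have h7 : ⟪H x v, H x v⟫ = ⟪v, H x (H x v)⟫ := (h.pos x).isSymmetric v (H x v)
        rw [h6] at h7
        simpa using h7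
      by_contra hne
      have hinj := ((LinearMap.equivOfDetNeZero (H x : E →ₗ[ℝ] E) hne).injective)
      apply hv0
      apply hinj
      simpa using h4
    have hμ : μ.real K = 0 := by
      have h1 : K ⊆ frontier K := by
        rw [frontier, hint, Set.sdiff_empty]
        exact subset_closure
      rw [measureReal_def, measure_mono_null h1 (hK.addHaar_frontier μ), ENNReal.toReal_zero]
    simp [hdet, hμ]
  · have hinj := h.gradient_injective hint
    have hd : ∀ x ∈ Set.univ, HasFDerivWithinAt G (H x) Set.univ x :=
      fun x _ => (h.hess x).hasFDerivWithinAt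
    have hdet : ∀ x, |(H x).det| • (1 : ℝ) = (H x).det := fun x => by
      rw [abs_of_nonneg (det_nonneg_of_isPositive (h.pos x)), smul_eq_mul, mul_one]
    have hsub : G '' Set.univ ⊆ K := by
      rintro _ ⟨x, -, rfl⟩
      exact h.mem x
    have hsup : interior K ⊆ G '' Set.univ := by
      rw [Set.image_univ]
      exact h.interior_subset_range
    have h1 := integrableOn_image_iff_integrableOn_abs_det_fderiv_smul μ MeasurableSet.univ hd
      hinj.injOn (fun _ => (1 : ℝ))
    have h2 := integral_image_eq_integral_abs_det_fderiv_smul μ MeasurableSet.univ hd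
      hinj.injOn (fun _ => (1 : ℝ))
    simp only [hdet, Measure.restrict_univ, integrableOn_univ] at h1 h2
    have hfin : μ K < ⊤ := hb.measure_lt_top
    refine ⟨h1.1 ?_, ?_⟩
    · exact integrableOn_const (ne_top_of_le_ne_top hfin.ne (measure_mono hsub))
    · rw [← h2, setIntegral_const, smul_eq_mul, mul_one]
      refine le_antisymm (measureReal_mono hsub hfin.ne) ?_
      -- The image of `G` lies between the interior of `K` and `K`, which differ by a null set as
      -- the frontier of a convex set is null.
      have h3 : μ.real K ≤ μ.real (interior K) := by
        have h4 : μ K ≤ μ (interior K) + μ (frontier K) := by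
          refine (measure_mono ?_).trans (measure_union_le _ _)
          rw [← closure_eq_interior_union_frontier]
          exact subset_closure
        rw [hK.addHaar_frontier μ, add_zero] at h4
        exact ENNReal.toReal_mono (ne_top_of_le_ne_top hfin.ne (measure_mono interior_subset)) h4
      exact h3.trans (measureReal_mono hsup
        (ne_top_of_le_ne_top hfin.ne (measure_mono hsub)))

end Potentials

end MixedIntegral

namespace MixedIntegral

/-! ### Alternating sums of determinants and of volumes -/

section AlternatingSum

open MeasureTheory

/-- The terms of `S` and `insert i S` cancel in pairs. -/
theorem sum_neg_one_pow_card_mul_eq_zero {ι R : Type*} [Fintype ι] [DecidableEq ι] [CommRing R]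
    (F : Finset ι → R) (i : ι) (hF : ∀ S, i ∉ S → F (insert i S) = F S) :
    ∑ S : Finset ι, (-1 : R) ^ S.card * F S = 0 := by
  rw [← Finset.powerset_univ, ← Finset.insert_erase (Finset.mem_univ i),
    Finset.sum_powerset_insert (Finset.notMem_erase i _), ← Finset.sum_add_distrib]
  refine Finset.sum_eq_zero fun S hS => ?_
  have hi : i ∉ S := fun h => Finset.notMem_erase i _ (Finset.mem_powerset.1 hS h)
  rw [hF S hi, Finset.card_insert_of_notMem hi, pow_succ]
  ring

/-- The alternating sum of the determinants of the partial sums of a family of more than `d`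
matrices of size `d` vanishes. -/
theorem sum_neg_one_pow_card_mul_det_sum {ι R : Type*} [Fintype ι] [CommRing R]
    {d : ℕ} (hd : d < Fintype.card ι) (A : ι → Matrix (Fin d) (Fin d) R) :
    ∑ S : Finset ι, (-1 : R) ^ S.card * (∑ i ∈ S, A i).det = 0 := by
  classical
  -- Multilinearity in the rows: `r k` is the index of the matrix supplying row `k`. For fixed `r`,
  -- the term depends on `S` only through whether `S` contains the range of `r`.
  have hexp : ∀ S : Finset ι, (∑ i ∈ S, A i).det =
      ∑ r : Fin d → ι, if ∀ k, r k ∈ S then (Matrix.of fun k => A (r k) k).det else 0 := by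
    intro S
    have h := (Matrix.detRowAlternating (R := R) (n := Fin d)).toMultilinearMap.map_sum_finset
      (fun k i => A i k) (fun _ => S)
    rw [← Finset.sum_filter]
    have h1 : (∑ i ∈ S, A i) = fun k => ∑ i ∈ S, A i k := by
      funext k
      exact Finset.sum_apply _ _ _
    have h2 : Finset.univ.filter (fun r : Fin d → ι => ∀ k, r k ∈ S) =
        Fintype.piFinset fun _ => S := by
      ext r
      simp
    rw [h1, h2]
    exact h
  simp only [hexp, Finset.mul_sum]
  rw [Finset.sum_comm]
  refine Finset.sum_eq_zero fun r _ => ?_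
  -- There are more matrices than rows, so some index is never used and the sum over `S` cancels in
  -- pairs.
  obtain ⟨i, hi⟩ : ∃ i, ∀ k, r k ≠ i := by
    by_contra! hcon
    have := Fintype.card_le_of_surjective r hcon
    rw [Fintype.card_fin] at this
    omega
  refine sum_neg_one_pow_card_mul_eq_zero _ i fun S _ => ?_
  simp [Finset.mem_insert, hi]

/-- Nonemptiness fills in the coordinates outside `S`. Families on all of `ι` suit both the closure
of a product and the format of `supConvolution`. -/
theorem mem_finset_sum_iff {ι E : Type*} [AddCommMonoid E] {K : ι → Set E}
    (hne : ∀ i, (K i).Nonempty) (S : Finset ι) (x : E) :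
    x ∈ ∑ i ∈ S, K i ↔ ∃ y : ι → E, (∀ i, y i ∈ K i) ∧ ∑ i ∈ S, y i = x := by
  classical
  rw [Set.mem_finsetSum]
  constructor
  · rintro ⟨g, hg, rfl⟩
    choose k hk using hne
    refine ⟨fun i => if i ∈ S then g i else k i, fun i => ?_, ?_⟩
    · by_cases hi : i ∈ S
      · simpa [hi] using hg hi
      · simpa [hi] using hk i
    · exact Finset.sum_congr rfl fun i hi => by simp [hi]
  · rintro ⟨y, hy, rfl⟩
    exact ⟨y, fun {i} _ => hy i, rfl⟩

theorem convex_finset_sum {ι E : Type*} [AddCommGroup E] [Module ℝ E] {K : ι → Set E}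
    (S : Finset ι) (h : ∀ i ∈ S, Convex ℝ (K i)) : Convex ℝ (∑ i ∈ S, K i) := by
  classical
  induction S using Finset.induction_on with
  | empty => simpa using convex_zero
  | insert i S hi ih =>
    rw [Finset.sum_insert hi]
    exact (h i (by simp)).add (ih fun j hj => h j (by simp [hj]))

theorem isBounded_finset_sum {ι E : Type*} [SeminormedAddCommGroup E] {K : ι → Set E}
    (S : Finset ι) (h : ∀ i ∈ S, Bornology.IsBounded (K i)) :
    Bornology.IsBounded (∑ i ∈ S, K i) := by
  classical
  induction S using Finset.induction_on with
  | empty => simp [← Set.singleton_zero]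
  | insert i S hi ih =>
    rw [Finset.sum_insert hi]
    exact (h i (by simp)).add (ih fun j hj => h j (by simp [hj]))

/-- Each volume is the integral of the determinant of a partial sum of Hessians, so the signed sum
is the integral of a pointwise vanishing function. -/
theorem sum_neg_one_pow_card_mul_volume_convexHull {ι E : Type*} [Fintype ι]
    [NormedAddCommGroup E] [InnerProductSpace ℝ E] [FiniteDimensional ℝ E] [MeasurableSpace E]
    [BorelSpace E] (μ : Measure E) [μ.IsAddHaarMeasure]
    (hd : Module.finrank ℝ E < Fintype.card ι) (s : ι → Finset E) (hs : ∀ i, (s i).Nonempty) :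
    ∑ S : Finset ι, (-1 : ℝ) ^ S.card * μ.real (∑ i ∈ S, convexHull ℝ (s i : Set E)) = 0 := by
  choose φ G H h using fun i => exists_isPotential_convexHull (s i) (hs i)
  have hint : ∀ S : Finset ι, Integrable (fun x => (∑ i ∈ S, H i x).det) μ ∧
      ∫ x, (∑ i ∈ S, H i x).det ∂μ = μ.real (∑ i ∈ S, convexHull ℝ (s i : Set E)) := fun S =>
    (IsPotential.sum S fun i _ => h i).integral_det μ
      (convex_finset_sum S fun i _ => convex_convexHull ℝ _)
      (isBounded_finset_sum S fun i _ =>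
        ((s i).finite_toSet.isCompact_convexHull ℝ).isBounded)
  simp only [← fun S => (hint S).2, ← integral_const_mul]
  rw [← integral_finsetSum _ fun S _ => (hint S).1.const_mul _]
  refine integral_eq_zero_of_ae (Filter.Eventually.of_forall fun x => ?_)
  set b := (stdOrthonormalBasis ℝ E).toBasis
  have := sum_neg_one_pow_card_mul_det_sum hd fun i => LinearMap.toMatrix b b (H i x : E →ₗ[ℝ] E)
  rw [Pi.zero_apply, ← this]
  refine Finset.sum_congr rfl fun S _ => ?_
  rw [← map_sum, LinearMap.det_toMatrix]
  congr 2
  simp [ContinuousLinearMap.det]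

/-- The volumes of Minkowski sums of bounded convex sets are limits of the volumes of the
Minkowski sums of finite convex hulls. -/
theorem exists_tendsto_volume_convexHull {ι E : Type*} [Finite ι]
    [NormedAddCommGroup E] [NormedSpace ℝ E] [FiniteDimensional ℝ E] [MeasurableSpace E]
    [BorelSpace E] (μ : Measure E) [μ.IsAddHaarMeasure] (K : ι → Set E)
    (hK : ∀ i, Convex ℝ (K i)) (hb : ∀ i, Bornology.IsBounded (K i))
    (hne : ∀ i, (K i).Nonempty) :
    ∃ s : ℕ → ι → Finset E, (∀ j i, (s j i).Nonempty) ∧ ∀ S : Finset ι,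
      Filter.Tendsto (fun j => μ.real (∑ i ∈ S, convexHull ℝ (s j i : Set E))) Filter.atTop
        (nhds (μ.real (∑ i ∈ S, K i))) := by
  classical
  have hne' : ∀ i, Nonempty (K i) := fun i => (hne i).to_subtype
  -- The approximants are the hulls of initial segments of a dense sequence in `K i`; they increase
  -- with `j`.
  set u : ι → ℕ → E := fun i m => (TopologicalSpace.denseSeq (K i) m : E) with hu
  have huK : ∀ i m, u i m ∈ K i := fun i m => (TopologicalSpace.denseSeq (K i) m).2
  have hdense : ∀ i, K i ⊆ closure (Set.range (u i)) := by
    intro i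
    have h1 := (TopologicalSpace.denseRange_denseSeq (K i))
    have h2 := Subtype.dense_iff.1 h1
    refine h2.trans (closure_mono ?_)
    rintro _ ⟨_, ⟨m, rfl⟩, rfl⟩
    exact ⟨m, rfl⟩
  set s : ℕ → ι → Finset E := fun j i => (Finset.range (j + 1)).image (u i) with hs
  have hsne : ∀ j i, (s j i).Nonempty := fun j i => by simp [hs]
  have hsK : ∀ j i, convexHull ℝ (s j i : Set E) ⊆ K i := fun j i =>
    convexHull_min (by
      intro x hx
      simp only [hs, Finset.coe_image] at hx
      obtain ⟨m, -, rfl⟩ := hx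
      exact huK i m) (hK i)
  have hmono : ∀ i, Monotone fun j => convexHull ℝ (s j i : Set E) := fun i j k hjk => by
    refine convexHull_mono (Finset.coe_subset.2 (Finset.image_subset_image ?_))
    exact Finset.range_mono (by omega)
  refine ⟨s, hsne, fun S => ?_⟩
  set B : ℕ → Set E := fun j => ∑ i ∈ S, convexHull ℝ (s j i : Set E) with hB
  have hBmono : Monotone B := fun j k hjk =>
    Set.finsetSum_subset_finsetSum S _ _ fun i _ => hmono i hjk
  have hBconv : ∀ j, Convex ℝ (B j) := fun j =>
    convex_finset_sum S fun i _ => convex_convexHull ℝ _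
  have hUconv : Convex ℝ (⋃ j, B j) :=
    (directed_of_isDirected_le hBmono).convex_iUnion fun {j} => hBconv j
  have hsub : (⋃ j, B j) ⊆ ∑ i ∈ S, K i :=
    Set.iUnion_subset fun j => Set.finsetSum_subset_finsetSum S _ _ fun i _ => hsK j i
  have hcl : ∑ i ∈ S, K i ⊆ closure (⋃ j, B j) := by
    intro x hx
    obtain ⟨y, hy, rfl⟩ := (mem_finset_sum_iff hne S x).1 hx
    have hy' : y ∈ closure (Set.pi Set.univ fun i => Set.range (u i)) := by
      rw [closure_pi_set]
      exact fun i _ => hdense i (hy i)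
    have hc : Continuous fun y : ι → E => ∑ i ∈ S, y i := by fun_prop
    refine map_mem_closure hc hy' fun z hz => ?_
    choose m hm using fun i => hz i (Set.mem_univ i)
    obtain ⟨j, hj⟩ := (Set.finite_range m).bddAbove
    refine Set.mem_iUnion.2 ⟨j, Set.finsetSum_mem_finsetSum S _ _ fun i _ => ?_⟩
    refine subset_convexHull ℝ _ ?_
    rw [← hm i, hs]
    simp only [Finset.coe_image]
    exact ⟨m i, by simpa [Nat.lt_succ_iff] using hj ⟨i, rfl⟩, rfl⟩
  have hbS : Bornology.IsBounded (∑ i ∈ S, K i) := isBounded_finset_sum S fun i _ => hb i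
  have hfin : μ (∑ i ∈ S, K i) ≠ ⊤ := hbS.measure_lt_top.ne
  -- The Minkowski sum lies between a convex set and its closure, so it has the same measure.
  have hμ : μ (⋃ j, B j) = μ (∑ i ∈ S, K i) := by
    refine le_antisymm (measure_mono hsub) ((measure_mono hcl).trans ?_)
    rw [closure_eq_self_union_frontier]
    refine (measure_union_le _ _).trans ?_
    rw [hUconv.addHaar_frontier μ, add_zero]
  rw [measureReal_def, ← hμ]
  refine (ENNReal.tendsto_toReal ?_).comp (tendsto_measure_iUnion_atTop hBmono)
  rwa [hμ]

/-- The alternating sum of the volumes of the partial Minkowski sums of a family of more than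
`dim E` bounded convex sets in `E` vanishes. -/
theorem sum_neg_one_pow_card_mul_volume_sum {ι E : Type*} [Fintype ι]
    [NormedAddCommGroup E] [NormedSpace ℝ E] [FiniteDimensional ℝ E] [MeasurableSpace E]
    [BorelSpace E] (μ : Measure E) [μ.IsAddHaarMeasure]
    (hd : Module.finrank ℝ E < Fintype.card ι) (K : ι → Set E) (hK : ∀ i, Convex ℝ (K i))
    (hb : ∀ i, Bornology.IsBounded (K i)) (hne : ∀ i, (K i).Nonempty) :
    ∑ S : Finset ι, (-1 : ℝ) ^ S.card * μ.real (∑ i ∈ S, K i) = 0 := by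
  classical
  obtain ⟨s, hs, hlim⟩ := exists_tendsto_volume_convexHull μ K hK hb hne
  have h1 := tendsto_finsetSum Finset.univ fun S (_ : S ∈ Finset.univ) =>
    (hlim S).const_mul ((-1 : ℝ) ^ S.card)
  refine tendsto_nhds_unique h1 (tendsto_const_nhds.congr fun j => ?_)
  -- Potentials need an inner product, so the identity is transported from Euclidean space along a
  -- linear isomorphism, with the pushed-forward measure.
  set e : E ≃L[ℝ] EuclideanSpace ℝ (Fin (Module.finrank ℝ E)) := toEuclidean
  have hH : (μ.map e).IsAddHaarMeasure := e.isAddHaarMeasure_map μ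
  have h2 := sum_neg_one_pow_card_mul_volume_convexHull (ι := ι) (μ.map e) (by simpa using hd)
    (fun i => (s j i).image e) fun i => (hs j i).image e
  rw [← h2]
  refine Finset.sum_congr rfl fun S _ => ?_
  congr 1
  have h3 : ∑ i ∈ S, convexHull ℝ (((s j i).image e : Finset _) : Set _) =
      e '' ∑ i ∈ S, convexHull ℝ (s j i : Set E) := by
    rw [Set.image_finsetSum]
    refine Finset.sum_congr rfl fun i _ => ?_
    rw [Finset.coe_image]
    exact (e.toLinearMap.image_convexHull _).symm
  rw [h3, measureReal_def, measureReal_def]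
  congr 1
  refine (e.toHomeomorph.measurableEmbedding.map_apply _ _).trans ?_
  congr 1
  exact Set.preimage_image_eq _ e.injective

theorem sum_finset_fin_succ {M : Type*} [AddCommMonoid M] {n : ℕ}
    (F : Finset (Fin (n + 1)) → M) :
    ∑ S, F S = ∑ T : Finset (Fin n), F (T.map Fin.castSuccEmb) +
      ∑ T : Finset (Fin n), F (insert (Fin.last n) (T.map Fin.castSuccEmb)) := by
  have hlast : Fin.last n ∉ (Finset.univ : Finset (Fin n)).map Fin.castSuccEmb := by simp
  have key : ∀ f : Finset (Fin (n + 1)) → M,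
      ∑ S ∈ ((Finset.univ : Finset (Fin n)).map Fin.castSuccEmb).powerset, f S =
        ∑ T : Finset (Fin n), f (T.map Fin.castSuccEmb) := by
    intro f
    symm
    refine Finset.sum_bij (fun T _ => T.map Fin.castSuccEmb) (fun T _ => ?_)
      (fun T _ T' _ h => Finset.map_injective _ h) (fun S hS => ?_) fun T _ => rfl
    · exact Finset.mem_powerset.2 (Finset.map_subset_map.2 (Finset.subset_univ T))
    · obtain ⟨T, -, rfl⟩ := Finset.subset_map_iff.1 (Finset.mem_powerset.1 hS)
      exact ⟨T, Finset.mem_univ _, rfl⟩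
  rw [← Finset.powerset_univ, Fin.univ_castSuccEmb, Finset.cons_eq_insert,
    Finset.sum_powerset_insert hlast, key, key]

/-- Adding a bounded convex set to all Minkowski sums in the definition of the mixed volume does
not change the value. -/
theorem sum_neg_one_pow_mul_volume_sum_add {E : Type*} [NormedAddCommGroup E] [NormedSpace ℝ E]
    [FiniteDimensional ℝ E] [MeasurableSpace E] [BorelSpace E] (μ : Measure E)
    [μ.IsAddHaarMeasure] {n : ℕ} (hd : Module.finrank ℝ E = n) (Q : Fin n → Set E)
    (hQ : ∀ i, Convex ℝ (Q i)) (hQb : ∀ i, Bornology.IsBounded (Q i))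
    (hQne : ∀ i, (Q i).Nonempty) {K : Set E} (hK : Convex ℝ K) (hKb : Bornology.IsBounded K)
    (hKne : K.Nonempty) :
    ∑ T : Finset (Fin n), (-1 : ℝ) ^ (n - T.card) * μ.real (∑ i ∈ T, Q i + K) =
      mixedVolume μ Q := by
  have h := sum_neg_one_pow_card_mul_volume_sum (ι := Fin (n + 1)) μ (by simp [hd])
    (Fin.snoc (α := fun _ => Set E) Q K) (fun i => ?_) (fun i => ?_) (fun i => ?_)
  · rw [sum_finset_fin_succ] at h
    have hsign : ∀ T : Finset (Fin n), (-1 : ℝ) ^ (n - T.card) = (-1) ^ n * (-1) ^ T.card := by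
      intro T
      have hT : T.card ≤ n := by simpa using Finset.card_le_univ T
      have h1 : (-1 : ℝ) ^ T.card * (-1) ^ T.card = 1 := by
        rw [← mul_pow]
        simp
      have h2 := pow_sub_mul_pow (-1 : ℝ) hT
      rw [← h2, mul_assoc, h1, mul_one]
    have hlast : ∀ T : Finset (Fin n), Fin.last n ∉ T.map Fin.castSuccEmb := fun T => by simp
    simp only [Finset.sum_insert (hlast _), Finset.card_insert_of_notMem (hlast _),
      Finset.sum_map, Finset.card_map, Fin.coe_castSuccEmb, Fin.snoc_castSucc, Fin.snoc_last,
      pow_succ, mul_neg, mul_one, neg_mul, Finset.sum_neg_distrib] at h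
    simp only [mixedVolume, hsign, mul_assoc, ← Finset.mul_sum]
    simp only [add_comm K] at h
    congr 1
    linarith
  all_goals
    refine Fin.lastCases ?_ (fun j => ?_) i <;> simp [*]

end AlternatingSum

end MixedIntegral

namespace MixedIntegral

/-! ### Supergradients, finiteness of `f` and the maximum of the Legendre dual -/

section Legendre

/-- Weak separation of a point from a convex set to whose interior it does not belong. -/
theorem exists_dual_ne_zero_le_of_notMem_interior {E : Type*} [NormedAddCommGroup E]
    [NormedSpace ℝ E] [FiniteDimensional ℝ E] {C : Set E} (hC : Convex ℝ C) (hne : C.Nonempty)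
    {p : E} (hp : p ∉ interior C) :
    ∃ φ : StrongDual ℝ E, φ ≠ 0 ∧ ∀ x ∈ C, φ x ≤ φ p := by
  rcases (interior C).eq_empty_or_nonempty with hint | hint
  · obtain ⟨φ, hφ0, hφ⟩ := exists_dual_ne_zero_of_interior_eq_empty hC hne hint
    obtain ⟨c, hc⟩ := hne
    rcases le_total (φ c) (φ p) with h | h
    · exact ⟨φ, hφ0, fun x hx => (hφ x hx c hc).trans_le h⟩
    · refine ⟨-φ, neg_ne_zero.2 hφ0, fun x hx => ?_⟩
      have := hφ x hx c hc
      simp only [neg_apply]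
      linarith
  · obtain ⟨φ, hφ0, hφ⟩ := geometric_hahn_banach_of_nonempty_interior_point hC hp hint
    exact ⟨φ, hφ0, hφ⟩

variable {V : Type*} [NormedAddCommGroup V] [NormedSpace ℝ V] {f : V → EReal}

theorem legendreDual_le (f : V → EReal) (x : StrongDual ℝ V) (u : V) :
    legendreDual f x ≤ ((x u : ℝ) : EReal) - f u :=
  iInf_le _ u

/-- The real hypograph of a concave function is convex. -/
theorem IsConcave.convex_hypograph (hf : IsConcave f) :
    Convex ℝ {p : V × ℝ | (p.2 : EReal) ≤ f p.1} := by
  rintro ⟨u, a⟩ ha ⟨v, b⟩ hb s t hs ht hst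
  obtain rfl : t = 1 - s := by linarith
  simp only [Set.mem_ofPred_eq] at ha hb
  simp only [Set.mem_ofPred_eq, Prod.smul_mk, Prod.mk_add_mk, smul_eq_mul]
  refine le_trans ?_ (hf.concave u v s hs (by linarith))
  rw [EReal.coe_add, EReal.coe_mul, EReal.coe_mul]
  exact add_le_add (mul_le_mul_of_nonneg_left ha (by exact_mod_cast hs))
    (mul_le_mul_of_nonneg_left hb (by exact_mod_cast ht))

theorem IsConcave.convex_effectiveDomain (hf : IsConcave f) : Convex ℝ (effectiveDomain f) := by
  have h : effectiveDomain f = LinearMap.fst ℝ V ℝ '' {p : V × ℝ | (p.2 : EReal) ≤ f p.1} := by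
    ext u
    simp only [effectiveDomain, Set.mem_ofPred_eq, Set.mem_image, Prod.exists]
    constructor
    · intro hu
      exact ⟨u, (f u).toReal, EReal.coe_toReal_le hu, rfl⟩
    · rintro ⟨v, a, ha, rfl⟩ hbot
      simp only [LinearMap.fst_apply] at hbot
      rw [hbot] at ha
      exact absurd ha (by simp)
  rw [h]
  exact hf.convex_hypograph.linear_image _

/-- A concave function has a supergradient at each interior point of its effective domain. -/
theorem IsConcave.exists_supergradient [FiniteDimensional ℝ V] (hf : IsConcave f) {u : V}
    (hu : u ∈ interior (effectiveDomain f)) :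
    ∃ x : StrongDual ℝ V, ∀ v, f v ≤ f u + ((x (v - u) : ℝ) : EReal) := by
  have hu0 : f u ≠ ⊥ := interior_subset hu
  obtain ⟨c, hc⟩ : ∃ c : ℝ, f u = c := ⟨(f u).toReal, (EReal.coe_toReal (hf.ne_top u) hu0).symm⟩
  have hnot : ((u, c) : V × ℝ) ∉ interior {p : V × ℝ | (p.2 : EReal) ≤ f p.1} := by
    intro hmem
    have hcont : Filter.Tendsto (fun t : ℝ => ((u, c + t) : V × ℝ)) (nhdsWithin 0 (Set.Ioi 0))
        (nhds (u, c)) := by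
      have : Continuous fun t : ℝ => ((u, c + t) : V × ℝ) := by fun_prop
      have h := this.tendsto 0
      simp only [add_zero] at h
      exact h.mono_left nhdsWithin_le_nhds
    obtain ⟨t, ht, ht0⟩ :=
      ((hcont.eventually (mem_interior_iff_mem_nhds.1 hmem)).and self_mem_nhdsWithin).exists
    have h1 : ((c + t : ℝ) : EReal) ≤ f u := ht
    rw [hc, EReal.coe_le_coe_iff] at h1
    have : (0 : ℝ) < t := ht0
    linarith
  obtain ⟨φ, hφ0, hφ⟩ := exists_dual_ne_zero_le_of_notMem_interior hf.convex_hypograph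
    ⟨(u, c), hc.ge⟩ hnot
  set y : StrongDual ℝ V := φ.comp (ContinuousLinearMap.inl ℝ V ℝ) with hy
  set a : ℝ := φ (0, 1) with ha
  have hφya : ∀ v s, φ (v, s) = y v + s * a := by
    intro v s
    have : ((v, s) : V × ℝ) = (v, 0) + s • (0, 1) := by simp
    rw [this, map_add, map_smul, smul_eq_mul]
    rfl
  have hle : ∀ v (s : ℝ), (s : EReal) ≤ f v → y v + s * a ≤ y u + c * a := by
    intro v s hs
    have := hφ (v, s) hs
    rwa [hφya, hφya] at this
  have ha0 : 0 ≤ a := by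
    have := hle u (c - 1) (by
      rw [hc, EReal.coe_le_coe_iff]
      linarith)
    linarith
  -- A vertical supporting hyperplane would give a linear form with a local maximum at the interior
  -- point `u`, hence zero.
  have ha1 : a ≠ 0 := by
    intro h0
    have hle' : ∀ v ∈ effectiveDomain f, y v ≤ y u := by
      intro v hv
      have := hle v (f v).toReal (EReal.coe_toReal_le hv)
      simpa [h0] using this
    have hmax : IsLocalMax y u :=
      Filter.mem_of_superset (mem_interior_iff_mem_nhds.1 hu) hle'
    have hy0 : y = 0 := hmax.hasFDerivAt_eq_zero y.hasFDerivAt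
    apply hφ0
    ext v
    · simpa [hφya] using congrArg (fun L : StrongDual ℝ V => L v) hy0
    · simp [hφya, h0]
  have hapos : 0 < a := lt_of_le_of_ne ha0 ha1.symm
  refine ⟨-(a⁻¹ • y), fun v => ?_⟩
  rcases eq_or_ne (f v) ⊥ with hv | hv
  · simp [hv]
  · have h1 := hle v (f v).toReal (EReal.coe_toReal_le hv)
    rw [hc, ← EReal.coe_toReal (hf.ne_top v) hv, ← EReal.coe_add, EReal.coe_le_coe_iff]
    simp only [neg_apply, smul_apply, smul_eq_mul, map_sub]
    have h2 : (f v).toReal * a ≤ (c + -(a⁻¹ * (y v - y u))) * a := by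
      field_simp
      linarith
    have h3 := le_of_mul_le_mul_right h2 hapos
    linarith

theorem legendreDual_ne_bot {x : StrongDual ℝ V} {c : ℝ} (h : ∀ u, f u ≤ ((x u + c : ℝ) : EReal)) :
    legendreDual f x ≠ ⊥ := by
  have h1 : ((-c : ℝ) : EReal) ≤ legendreDual f x := by
    refine le_iInf fun u => ?_
    rcases eq_or_ne (f u) ⊥ with hu | hu
    · simp [hu]
    · obtain ⟨d, hd⟩ : ∃ d : ℝ, f u = d :=
        ⟨(f u).toReal, (EReal.coe_toReal ((h u).trans_lt (EReal.coe_lt_top _)).ne hu).symm⟩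
      have := h u
      rw [hd, EReal.coe_le_coe_iff] at this
      rw [hd, ← EReal.coe_sub, EReal.coe_le_coe_iff]
      linarith
  intro h2
  rw [h2] at h1
  exact absurd h1 (by simp)

/-- The stability set of a concave function is nonempty. -/
theorem IsConcave.stabilitySet_nonempty [FiniteDimensional ℝ V] (hf : IsConcave f) :
    (stabilitySet f).Nonempty := by
  obtain ⟨d, hd⟩ := hf.exists_ne_bot
  set D := effectiveDomain f with hD
  have hdD : d ∈ D := hd
  set W := vectorSpan ℝ D with hW
  obtain ⟨P, hP⟩ := W.subtype.exists_leftInverse_of_injective W.ker_subtype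
  have hPW : ∀ w : W, P w = w := fun w => congrArg (fun L : W →ₗ[ℝ] W => L w) hP
  -- An affine retraction onto the affine hull of `D`. The function `f ∘ q` agrees with `f` on `D`,
  -- and its domain contains the translate `d + ker P`, so it has interior points even when `D` does
  -- not.
  set q : V → V := fun u => d + (P (u - d) : V) with hq
  have hqD : ∀ u ∈ D, q u = u := by
    intro u hu
    have := hPW ⟨u - d, vsub_mem_vectorSpan ℝ hu hdD⟩
    simp only [hq]
    rw [this]
    simp
  have hF : IsConcave (f ∘ q) := by
    refine ⟨fun u => hf.ne_top _, ⟨d, by simpa [hqD d hdD] using hd⟩, fun u v t h0 h1 => ?_⟩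
    have h2 : q (t • u + (1 - t) • v) = t • q u + (1 - t) • q v := by
      have h3 : t • u + (1 - t) • v - d = t • (u - d) + (1 - t) • (v - d) := by module
      simp only [hq, h3, map_add, map_smul, Submodule.coe_add, Submodule.coe_smul]
      module
    simp only [Function.comp_apply, h2]
    exact hf.concave _ _ t h0 h1
  have hint : (interior (effectiveDomain (f ∘ q))).Nonempty := by
    by_contra hcon
    have hdF : d ∈ effectiveDomain (f ∘ q) := by
      change f (q d) ≠ ⊥
      rwa [hqD d hdD]
    obtain ⟨φ, hφ0, hφ⟩ := exists_dual_ne_zero_of_interior_eq_empty hF.convex_effectiveDomain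
      ⟨d, hdF⟩ (Set.not_nonempty_iff_eq_empty.1 hcon)
    have hW0 : W ≤ LinearMap.ker (φ : V →ₗ[ℝ] ℝ) := by
      rw [hW, vectorSpan, Submodule.span_le]
      rintro _ ⟨u, hu, v, hv, rfl⟩
      have hu' : u ∈ effectiveDomain (f ∘ q) := by
        change f (q u) ≠ ⊥
        rwa [hqD u hu]
      have hv' : v ∈ effectiveDomain (f ∘ q) := by
        change f (q v) ≠ ⊥
        rwa [hqD v hv]
      simp [hφ u hu' v hv']
    apply hφ0
    ext v
    have h1 : φ (P v : V) = 0 := hW0 (P v).2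
    have h2 : d + (v - P v) ∈ effectiveDomain (f ∘ q) := by
      change f (q _) ≠ ⊥
      have : q (d + (v - P v)) = d := by
        simp [hq, hPW]
      rwa [this]
    have h3 := hφ _ h2 _ hdF
    simp only [map_add, map_sub, h1] at h3
    simpa using h3
  obtain ⟨u, hu⟩ := hint
  obtain ⟨x, hx⟩ := hF.exists_supergradient hu
  have hu0 : (f ∘ q) u ≠ ⊥ := interior_subset hu
  refine ⟨x, legendreDual_ne_bot (c := ((f ∘ q) u).toReal - x u) fun v => ?_⟩
  rcases eq_or_ne (f v) ⊥ with hv | hv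
  · simp [hv]
  · have h1 := hx v
    rw [Function.comp_apply, hqD v hv] at h1
    rw [← EReal.coe_toReal (hF.ne_top u) hu0, ← EReal.coe_add] at h1
    refine h1.trans_eq ?_
    rw [map_sub]
    congr 1
    ring

/-- A concave function with bounded stability set takes only finite values. -/
theorem IsConcave.ne_bot_of_isBounded_stabilitySet [FiniteDimensional ℝ V] (hf : IsConcave f)
    (hb : Bornology.IsBounded (stabilitySet f)) (p : V) : f p ≠ ⊥ := by
  intro hp
  obtain ⟨x, hx⟩ := hf.stabilitySet_nonempty
  obtain ⟨y, hy0, hy⟩ := exists_dual_ne_zero_le_of_notMem_interior hf.convex_effectiveDomain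
    hf.exists_ne_bot (p := p) fun h => interior_subset h hp
  have hne_top : legendreDual f x ≠ ⊤ := by
    obtain ⟨u, hu⟩ := hf.exists_ne_bot
    refine ((legendreDual_le f x u).trans_lt ?_).ne
    rw [← EReal.coe_toReal (hf.ne_top u) hu, ← EReal.coe_sub]
    exact EReal.coe_lt_top _
  obtain ⟨c, hc⟩ : ∃ c : ℝ, legendreDual f x = c :=
    ⟨_, (EReal.coe_toReal hne_top hx).symm⟩
  -- If `f p = ⊥`, a form `y` separating `p` from the domain lets any affine majorant of `f` be
  -- tilted by `-s • y`, which puts a whole ray in the bounded stability set.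
  have hray : ∀ s : ℝ, 0 ≤ s → x - s • y ∈ stabilitySet f := by
    intro s hs
    refine legendreDual_ne_bot (c := s * y p - c) fun u => ?_
    rcases eq_or_ne (f u) ⊥ with hu | hu
    · simp [hu]
    · have h1 := legendreDual_le f x u
      have h2 := mul_le_mul_of_nonneg_left (hy u hu) hs
      rw [hc, ← EReal.coe_toReal (hf.ne_top u) hu, ← EReal.coe_sub, EReal.coe_le_coe_iff] at h1
      rw [← EReal.coe_toReal (hf.ne_top u) hu, EReal.coe_le_coe_iff]
      simp only [sub_apply, smul_apply, smul_eq_mul]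
      linarith
  obtain ⟨R, hR⟩ := hb.exists_norm_le
  have hypos : 0 < ‖y‖ := norm_pos_iff.2 hy0
  have hR0 : 0 ≤ R := (norm_nonneg _).trans (hR x hx)
  set s := (R + ‖x‖ + 1) / ‖y‖ with hs
  have hs0 : 0 ≤ s := by positivity
  have h1 := hR _ (hray s hs0)
  have h2 : ‖s • y‖ = R + ‖x‖ + 1 := by
    rw [norm_smul, Real.norm_of_nonneg hs0, hs, div_mul_cancel₀ _ hypos.ne']
  have h3 : ‖s • y‖ ≤ ‖x - s • y‖ + ‖x‖ := by
    have := norm_sub_le x (x - s • y)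
    rw [sub_sub_cancel] at this
    linarith
  linarith

/-- A supergradient `x` at `0` satisfies `f u ≤ f 0 + x u`, so the infimum defining the dual at `x`
is attained at `u = 0`. -/
theorem IsConcave.exists_legendreDual_eq_neg [FiniteDimensional ℝ V] (hf : IsConcave f)
    (hb : Bornology.IsBounded (stabilitySet f)) :
    ∃ x, legendreDual f x = -f 0 := by
  have hD : effectiveDomain f = Set.univ :=
    Set.eq_univ_of_forall fun p => hf.ne_bot_of_isBounded_stabilitySet hb p
  obtain ⟨x, hx⟩ := hf.exists_supergradient (u := 0) (by simp [hD])
  refine ⟨x, le_antisymm ?_ (le_iInf fun u => ?_)⟩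
  · simpa using legendreDual_le f x 0
  · have h1 := hx u
    rw [sub_zero, ← EReal.coe_toReal (hf.ne_top u) (hf.ne_bot_of_isBounded_stabilitySet hb u),
      ← EReal.coe_toReal (hf.ne_top 0) (hf.ne_bot_of_isBounded_stabilitySet hb 0),
      ← EReal.coe_add, EReal.coe_le_coe_iff] at h1
    rw [← EReal.coe_toReal (hf.ne_top u) (hf.ne_bot_of_isBounded_stabilitySet hb u),
      ← EReal.coe_toReal (hf.ne_top 0) (hf.ne_bot_of_isBounded_stabilitySet hb 0),
      ← EReal.coe_neg, ← EReal.coe_sub, EReal.coe_le_coe_iff]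
    linarith

end Legendre

end MixedIntegral

namespace MixedIntegral

/-! ### Rational polytopes and lower bounds for the Legendre dual -/

section Polytopes

variable {V : Type*} [NormedAddCommGroup V] [NormedSpace ℝ V] {N : Submodule ℤ V}
  {P : Set (StrongDual ℝ V)}

theorem IsRationalPolyhedron.convex (hP : IsRationalPolyhedron N P) : Convex ℝ P := by
  obtain ⟨k, u, c, rfl⟩ := hP
  rw [Set.ofPred_forall]
  refine convex_iInter fun j x hx y hy a b ha hb hab => ?_
  simp only [Set.mem_ofPred_eq, add_apply, smul_apply, smul_eq_mul] at hx hy ⊢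
  have h1 : a * x (u j) + b * y (u j) + c j = a * (x (u j) + c j) + b * (y (u j) + c j) := by
    have : c j = (a + b) * c j := by rw [hab, one_mul]
    linear_combination this
  rw [h1]
  positivity

theorem IsRationalPolyhedron.isClosed (hP : IsRationalPolyhedron N P) : IsClosed P := by
  obtain ⟨k, u, c, rfl⟩ := hP
  rw [Set.ofPred_forall]
  exact isClosed_iInter fun j => isClosed_le continuous_const (by fun_prop)

theorem IsRationalPolytope.isCompact [FiniteDimensional ℝ V] (hP : IsRationalPolytope N P) :
    IsCompact P :=
  Metric.isCompact_of_isClosed_isBounded hP.1.isClosed hP.2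

/-- An extreme point is determined by its set of active constraints: if `x` and `y` have the same
ones, `x ± t • (x - y)` stays in `P` for small `t > 0`, with midpoint `x`. -/
theorem IsRationalPolyhedron.finite_extremePoints (hP : IsRationalPolyhedron N P) :
    (P.extremePoints ℝ).Finite := by
  obtain ⟨k, u, c, rfl⟩ := hP
  refine Set.Finite.of_injOn (f := fun x : StrongDual ℝ V => {j | x (u j) + c j = 0})
    (Set.mapsTo_univ _ _) (fun x hx y hy hxy => ?_) Set.finite_univ
  by_contra hne
  set d := x - y with hd
  have hxP : ∀ j, 0 ≤ x (u j) + c j := hx.1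
  have hev : ∀ᶠ t : ℝ in nhds 0, ∀ j, 0 ≤ (x + t • d) (u j) + c j := by
    rw [Filter.eventually_all]
    intro j
    rcases eq_or_ne (x (u j) + c j) 0 with h0 | h0
    · have h1 : y (u j) + c j = 0 := by
        exact (Set.ext_iff.1 hxy j).1 h0
      refine Filter.Eventually.of_forall fun t => ?_
      have h2 : d (u j) = 0 := by
        simp only [hd, sub_apply]
        linarith
      simp [h2, h0]
    · have hpos : 0 < x (u j) + c j := lt_of_le_of_ne (hxP j) h0.symm
      have hcont : Continuous fun t : ℝ => (x + t • d) (u j) + c j := by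
        simp only [add_apply, smul_apply]
        fun_prop
      have := hcont.tendsto 0
      simp only [zero_smul, add_zero] at this
      exact (this.eventually (lt_mem_nhds hpos)).mono fun t ht => ht.le
  have hev' : ∀ᶠ t : ℝ in nhds 0, ∀ j, 0 ≤ (x + (-t) • d) (u j) + c j := by
    have : Filter.Tendsto (fun t : ℝ => -t) (nhds 0) (nhds 0) := by
      simpa using (continuous_neg (G := ℝ)).tendsto 0
    exact this.eventually hev
  obtain ⟨t, ⟨ht, ht'⟩, ht0⟩ := (((hev.and hev').filter_mono nhdsWithin_le_nhds).and
    (self_mem_nhdsWithin (s := Set.Ioi (0 : ℝ)))).exists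
  have hseg : x ∈ openSegment ℝ (x + t • d) (x + (-t) • d) :=
    ⟨1 / 2, 1 / 2, by norm_num, by norm_num, by norm_num, by module⟩
  have h1 : x + t • d = x := hx.2 ht ht' hseg
  rw [add_eq_left, smul_eq_zero, or_iff_right (ne_of_gt ht0)] at h1
  exact hne (sub_eq_zero.1 h1)

theorem IsRationalPolytope.eq_convexHull_extremePoints [FiniteDimensional ℝ V]
    (hP : IsRationalPolytope N P) : P = convexHull ℝ (P.extremePoints ℝ) := by
  rw [← (hP.1.finite_extremePoints.isClosed_convexHull ℝ).closure_eq]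
  exact (closure_convexHull_extremePoints hP.isCompact hP.1.convex).symm

theorem superlevel_legendreDual (f : V → EReal) (t : ℝ) :
    {x | (t : EReal) ≤ legendreDual f x} =
      ⋂ u, {x : StrongDual ℝ V | (t : EReal) ≤ ((x u : ℝ) : EReal) - f u} := by
  ext x
  simp [legendreDual]

theorem setOf_le_coe_sub (f : V → EReal) (t : ℝ) (u : V) :
    {x : StrongDual ℝ V | (t : EReal) ≤ ((x u : ℝ) : EReal) - f u} = Set.univ ∨
    {x : StrongDual ℝ V | (t : EReal) ≤ ((x u : ℝ) : EReal) - f u} = ∅ ∨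
    ∃ c : ℝ, {x : StrongDual ℝ V | (t : EReal) ≤ ((x u : ℝ) : EReal) - f u} = {x | c ≤ x u} := by
  generalize f u = e
  induction e using EReal.rec with
  | bot =>
    left
    simp
  | coe c =>
    right
    right
    refine ⟨t + c, ?_⟩
    ext x
    simp only [Set.mem_ofPred_eq]
    rw [← EReal.coe_sub, EReal.coe_le_coe_iff]
    constructor <;> intro <;> linarith
  | top =>
    right
    left
    simp

theorem isClosed_superlevel_legendreDual (f : V → EReal) (t : ℝ) :
    IsClosed {x | (t : EReal) ≤ legendreDual f x} := by
  rw [superlevel_legendreDual]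
  refine isClosed_iInter fun u => ?_
  rcases setOf_le_coe_sub f t u with h | h | ⟨c, h⟩ <;> rw [h]
  · exact isClosed_univ
  · exact isClosed_empty
  · exact isClosed_le continuous_const (by fun_prop)

theorem convex_superlevel_legendreDual (f : V → EReal) (t : ℝ) :
    Convex ℝ {x | (t : EReal) ≤ legendreDual f x} := by
  rw [superlevel_legendreDual]
  refine convex_iInter fun u => ?_
  rcases setOf_le_coe_sub f t u with h | h | ⟨c, h⟩ <;> rw [h]
  · exact convex_univ
  · exact convex_empty
  · exact convex_halfSpace_ge ⟨fun x y => rfl, fun a x => rfl⟩ c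

/-- If the stability set is a polytope, the Legendre dual is bounded below on it. -/
theorem exists_le_legendreDual [FiniteDimensional ℝ V] {f : V → EReal}
    (hstab : IsRationalPolytope N (stabilitySet f)) :
    ∃ m : ℝ, ∀ x ∈ stabilitySet f, (m : EReal) ≤ legendreDual f x := by
  have hfin := hstab.1.finite_extremePoints
  -- The minimum over the finitely many extreme points suffices, because superlevel sets of the dual
  -- are convex.
  obtain ⟨m, hm⟩ := (hfin.image fun x => (legendreDual f x).toReal).bddBelow
  refine ⟨m, fun x hx => ?_⟩
  rw [hstab.eq_convexHull_extremePoints] at hx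
  refine convexHull_min (fun y hy => ?_) (convex_superlevel_legendreDual f m) hx
  have h1 : m ≤ (legendreDual f y).toReal := hm ⟨y, hy, rfl⟩
  have h2 : legendreDual f y ≠ ⊥ := hy.1
  exact (EReal.coe_le_coe_iff.2 h1).trans (EReal.coe_toReal_le h2)

end Polytopes

/-! ### Sup-convolutions with indicator functions -/

section SupConvolution

variable {E : Type*}

theorem effectiveDomain_indicatorFn (B : Set E) : effectiveDomain (indicatorFn B) = B := by
  ext x
  by_cases hx : x ∈ B <;> simp [effectiveDomain, indicatorFn, hx]

theorem sum_indicatorFn_eq_zero {ι : Type*} {T : Finset ι} {Q : ι → Set E} {y : ι → E}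
    (h : ∀ i ∈ T, y i ∈ Q i) : ∑ i ∈ T, indicatorFn (Q i) (y i) = 0 :=
  Finset.sum_eq_zero fun i hi => by simp [indicatorFn, h i hi]

theorem sum_indicatorFn_eq_bot {ι : Type*} {T : Finset ι} {Q : ι → Set E} {y : ι → E}
    {i : ι} (hi : i ∈ T) (h : y i ∉ Q i) : ∑ i ∈ T, indicatorFn (Q i) (y i) = ⊥ := by
  classical
  rw [← Finset.add_sum_erase _ _ hi]
  simp [indicatorFn, h]

variable [AddCommGroup E]

/-- The sup-convolution takes only the values `0` and `⊥`, and `toReal` sends `⊥` to `0`; no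
membership of `x` is needed. -/
theorem toReal_supConvolution_indicatorFn {ι : Type*} (S : Finset ι) (g : ι → E → EReal)
    (Q : ι → Set E) (hg : ∀ i ∈ S, g i = indicatorFn (Q i)) (x : E) :
    (supConvolution S g x).toReal = 0 := by
  have hsum : ∀ y : ι → E, ∑ i ∈ S, g i (y i) = 0 ∨ ∑ i ∈ S, g i (y i) = ⊥ := by
    intro y
    have h1 : ∑ i ∈ S, g i (y i) = ∑ i ∈ S, indicatorFn (Q i) (y i) :=
      Finset.sum_congr rfl fun i hi => by rw [hg i hi]
    rw [h1]
    by_cases h : ∀ i ∈ S, y i ∈ Q i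
    · exact Or.inl (sum_indicatorFn_eq_zero h)
    · push Not at h
      obtain ⟨i, hi, hy⟩ := h
      exact Or.inr (sum_indicatorFn_eq_bot hi hy)
  by_cases h : ∃ y : ι → E, ∑ i ∈ S, y i = x ∧ ∑ i ∈ S, g i (y i) = 0
  · obtain ⟨y, hy, hy0⟩ := h
    have : supConvolution S g x = 0 := by
      refine le_antisymm (iSup₂_le fun z _ => ?_) (hy0.ge.trans (le_iSup₂_of_le y hy le_rfl))
      rcases hsum z with h | h <;> simp [h]
    simp [this]
  · have : supConvolution S g x = ⊥ := by
      refine le_bot_iff.1 (iSup₂_le fun z hz => ?_)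
      rcases hsum z with h' | h'
      · exact absurd ⟨z, hz, h'⟩ h
      · exact h'.le
    simp [this]

/-- The strict superlevel sets of a sup-convolution of indicator functions with `g`. -/
theorem lt_supConvolution_snoc_iff {n : ℕ} {Q : Fin n → Set E} (hne : ∀ i, (Q i).Nonempty)
    (g : E → EReal) (T : Finset (Fin n)) (t : ℝ) (x : E) :
    (t : EReal) < supConvolution (insert (Fin.last n) (T.map Fin.castSuccEmb))
      (Fin.snoc (α := fun _ => E → EReal) (fun i => indicatorFn (Q i)) g) x ↔
    x ∈ ∑ i ∈ T, Q i + {y | (t : EReal) < g y} := by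
  have hlast : Fin.last n ∉ T.map Fin.castSuccEmb := by simp
  simp only [supConvolution, lt_iSup_iff, Finset.sum_insert hlast, Finset.sum_map,
    Fin.coe_castSuccEmb, Fin.snoc_castSucc, Fin.snoc_last, Set.mem_add, mem_finset_sum_iff hne]
  constructor
  · rintro ⟨y, rfl, hy⟩
    by_cases h : ∀ i ∈ T, y i.castSucc ∈ Q i
    · rw [sum_indicatorFn_eq_zero (y := fun i : Fin n => y i.castSucc) h, add_zero] at hy
      refine ⟨∑ i ∈ T, y i.castSucc, ?_, y (Fin.last n), hy, add_comm _ _⟩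
      exact (mem_finset_sum_iff hne T _).1
        (Set.finsetSum_mem_finsetSum T _ _ fun i hi => h i hi)
    · push Not at h
      obtain ⟨i, hi, hy'⟩ := h
      rw [sum_indicatorFn_eq_bot (y := fun i : Fin n => y i.castSucc) hi hy', EReal.add_bot] at hy
      exact absurd hy not_lt_bot
  · rintro ⟨_, ⟨y, hy, rfl⟩, z, hz, rfl⟩
    refine ⟨Fin.snoc (α := fun _ => E) y z, ?_, ?_⟩
    · simp [add_comm]
    · simp only [Fin.snoc_castSucc, Fin.snoc_last]
      rwa [sum_indicatorFn_eq_zero fun i _ => hy i, add_zero]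

end SupConvolution

/-! ### Layer cake formula and evaluation of the mixed integral -/

section LayerCake

open MeasureTheory

/-- Strict superlevel sets behave exactly under Minkowski sums, but closedness and convexity are
known for the non-strict ones; this increasing union transfers convexity and yields measurability.
-/
theorem iUnion_superlevel {E : Type*} (g : E → EReal) (t : ℝ) :
    {y | (t : EReal) < g y} = ⋃ k : ℕ, {y | ((t + 1 / (k + 1) : ℝ) : EReal) ≤ g y} := by
  ext y
  simp only [Set.mem_ofPred_eq, Set.mem_iUnion]
  constructor
  · intro h
    obtain ⟨s, hs, hs'⟩ := EReal.lt_iff_exists_real_btwn.1 h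
    obtain ⟨k, hk⟩ := exists_nat_one_div_lt (sub_pos.2 (EReal.coe_lt_coe_iff.1 hs))
    refine ⟨k, le_trans ?_ hs'.le⟩
    rw [EReal.coe_le_coe_iff]
    linarith
  · rintro ⟨k, hk⟩
    refine lt_of_lt_of_le ?_ hk
    rw [EReal.coe_lt_coe_iff]
    have : (0 : ℝ) < 1 / (k + 1) := Nat.one_div_pos_of_nat
    linarith

variable {E : Type*} [NormedAddCommGroup E] {g : E → EReal}

theorem convex_strict_superlevel [NormedSpace ℝ E] (hconv : ∀ t : ℝ, Convex ℝ {y | (t : EReal) ≤ g y}) (t : ℝ) :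
    Convex ℝ {y | (t : EReal) < g y} := by
  rw [iUnion_superlevel]
  refine (directed_of_isDirected_le fun j k hjk y hy => ?_).convex_iUnion fun {k} => hconv _
  rw [Set.mem_ofPred_eq] at hy ⊢
  refine le_trans ?_ hy
  rw [EReal.coe_le_coe_iff]
  gcongr

variable [MeasurableSpace E] [BorelSpace E]

theorem measurableSet_add_superlevel {C : Set E} (hC : IsCompact C)
    (hclosed : ∀ t : ℝ, IsClosed {y | (t : EReal) ≤ g y}) (t : ℝ) :
    MeasurableSet (C + {y | (t : EReal) < g y}) := by
  rw [iUnion_superlevel, Set.add_iUnion]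
  exact MeasurableSet.iUnion fun k => ((hclosed _).add_left_of_isCompact hC).measurableSet

/-- The layer cake formula for the sup-convolution of the indicator function of `C` with `g`. -/
theorem integral_eq_of_superlevel [NormedSpace ℝ E] [FiniteDimensional ℝ E] (μ : Measure E) [μ.IsAddHaarMeasure]
    {C : Set E} (hC : IsCompact C)
    (hclosed : ∀ t : ℝ, IsClosed {y | (t : EReal) ≤ g y})
    (hb : Bornology.IsBounded (effectiveDomain g)) {m M : ℝ}
    (hm : ∀ y ∈ effectiveDomain g, (m : EReal) ≤ g y) (hM : ∀ y, g y ≤ M) {h : E → EReal}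
    (hh : ∀ (t : ℝ) x, (t : EReal) < h x ↔ x ∈ C + {y | (t : EReal) < g y}) :
    IntegrableOn (fun t : ℝ => μ.real (C + {y | ((m + t : ℝ) : EReal) < g y}))
        (Set.Ioo 0 (M - m)) ∧
      ∫ x in C + effectiveDomain g, (h x).toReal ∂μ =
        m * μ.real (C + effectiveDomain g) +
          ∫ t in Set.Ioo 0 (M - m), μ.real (C + {y | ((m + t : ℝ) : EReal) < g y}) := by
  have hdom : effectiveDomain g = {y | (m : EReal) ≤ g y} := by
    refine Set.Subset.antisymm hm fun y hy hbot => ?_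
    rw [Set.mem_ofPred_eq, hbot] at hy
    exact absurd hy (by simp)
  have hbd : Bornology.IsBounded (C + effectiveDomain g) := hC.isBounded.add hb
  set B := C + effectiveDomain g with hB
  have hBfin : μ B ≠ ⊤ := hbd.measure_lt_top.ne
  have hBmeas : MeasurableSet B := by
    rw [hB, hdom]
    exact ((hclosed m).add_left_of_isCompact hC).measurableSet
  have hlev : ∀ t : ℝ, C + {y | (t : EReal) < g y} ⊆ B := fun t =>
    Set.add_subset_add_left fun y hy => ne_bot_of_gt hy
  have hupper : ∀ x, h x ≤ M := by
    intro x
    by_contra! hcon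
    obtain ⟨c, -, y, hy, -⟩ := (hh M x).1 hcon
    exact absurd (hM y) (not_le.2 hy)
  have hlower : ∀ x ∈ B, (m : EReal) ≤ h x := by
    rintro _ ⟨c, hc, y, hy, rfl⟩
    -- Since `hh` only controls strict levels, `m` is approached by real `t < m`.
    refine EReal.ge_of_forall_gt_iff_ge.1 fun t ht => ?_
    exact ((hh t _).2 ⟨c, hc, y, lt_of_lt_of_le ht (hm y hy), rfl⟩).le
  have hcoe : ∀ x ∈ B, ((h x).toReal : EReal) = h x := fun x hx =>
    EReal.coe_toReal ((hupper x).trans_lt (EReal.coe_lt_top M)).ne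
      (ne_bot_of_le_ne_bot (EReal.coe_ne_bot m) (hlower x hx))
  -- Subtracting `m` and extending by zero gives a nonnegative function on the whole space whose
  -- levels `t ≥ 0` are the required Minkowski sums.
  set F : E → ℝ := B.indicator fun x => (h x).toReal - m with hF
  have hF0 : ∀ x, 0 ≤ F x := by
    refine Set.indicator_nonneg fun x hx => ?_
    rw [sub_nonneg, ← EReal.coe_le_coe_iff, hcoe x hx]
    exact hlower x hx
  have hF1 : ∀ x ∈ B, F x ≤ M - m := by
    intro x hx
    rw [hF, Set.indicator_of_mem hx]
    refine sub_le_sub_right ?_ m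
    rw [← EReal.coe_le_coe_iff, hcoe x hx]
    exact hupper x
  have hFlev : ∀ t : ℝ, 0 ≤ t → {x | t < F x} = C + {y | ((m + t : ℝ) : EReal) < g y} := by
    intro t ht
    ext x
    rw [Set.mem_ofPred_eq, ← hh]
    by_cases hx : x ∈ B
    · rw [← hcoe x hx, EReal.coe_lt_coe_iff, hF, Set.indicator_of_mem hx, lt_sub_iff_add_lt']
    · rw [hF, Set.indicator_of_notMem hx, hh]
      exact iff_of_false (not_lt.2 ht) fun hmem => hx (hlev _ hmem)
  have hFmeas : Measurable F := by
    refine measurable_of_Ioi fun t => ?_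
    change MeasurableSet {x | t < F x}
    rcases lt_or_ge t 0 with ht | ht
    · have : {x | t < F x} = Set.univ := Set.eq_univ_of_forall fun x => ht.trans_le (hF0 x)
      rw [this]
      exact MeasurableSet.univ
    · rw [hFlev t ht]
      exact measurableSet_add_superlevel hC hclosed _
  have hFon : IntegrableOn F B μ := by
    refine Measure.integrableOn_of_bounded (M := M - m) hBfin hFmeas.aestronglyMeasurable ?_
    refine (ae_restrict_iff' hBmeas).2 (Filter.Eventually.of_forall fun x hx => ?_)
    rw [Real.norm_of_nonneg (hF0 x)]
    exact hF1 x hx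
  have hFint : Integrable F μ := by
    refine (integrableOn_iff_integrable_of_support_subset ?_).1 hFon
    exact Set.support_indicator_subset
  have hvanish : ∀ t : ℝ, M - m ≤ t → μ.real (C + {y | ((m + t : ℝ) : EReal) < g y}) = 0 := by
    intro t ht
    have : {y | ((m + t : ℝ) : EReal) < g y} = ∅ := by
      refine Set.eq_empty_of_forall_notMem fun y hy => ?_
      have h1 := lt_of_lt_of_le hy (hM y)
      rw [EReal.coe_lt_coe_iff] at h1
      linarith
    rw [this]
    simp
  have hanti : Antitone fun t : ℝ => μ.real (C + {y | ((m + t : ℝ) : EReal) < g y}) := by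
    intro s t hst
    refine measureReal_mono (Set.add_subset_add_left fun y hy => ?_)
      (ne_top_of_le_ne_top hBfin (measure_mono (hlev _)))
    rw [Set.mem_ofPred_eq] at hy ⊢
    refine lt_of_le_of_lt ?_ hy
    rw [EReal.coe_le_coe_iff]
    linarith
  refine ⟨?_, ?_⟩
  · exact ((hanti.antitoneOn _).integrableOn_isCompact isCompact_Icc).mono_set
      (Set.Ioo_subset_Icc_self (a := 0) (b := M - m))
  · have h1 : ∫ x in B, (h x).toReal ∂μ = ∫ x in B, (m + F x) ∂μ := by
      refine setIntegral_congr_fun hBmeas fun x hx => ?_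
      simp only [hF, Set.indicator_of_mem hx]
      ring
    have h2 : ∫ x in B, F x ∂μ = ∫ x, F x ∂μ :=
      setIntegral_eq_integral_of_forall_compl_eq_zero fun x hx => Set.indicator_of_notMem hx _
    rw [h1, integral_add (integrable_const_iff.2 (Or.inr ⟨by simpa using hBfin.lt_top⟩)) hFon, setIntegral_const, smul_eq_mul,
      mul_comm, h2, hFint.integral_eq_integral_meas_lt (Filter.Eventually.of_forall hF0)]
    congr 1
    rw [setIntegral_congr_fun measurableSet_Ioi
      (g := fun t : ℝ => μ.real (C + {y | ((m + t : ℝ) : EReal) < g y})) fun t ht => by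
        simp only [← hFlev t (le_of_lt ht)]]
    -- Levels `t ≥ M - m` are empty. The open interval keeps only levels that are nonempty when `M`
    -- is attained, as the volume identity requires.
    refine setIntegral_eq_of_subset_of_forall_sdiff_eq_zero measurableSet_Ioi
      Set.Ioo_subset_Ioi_self fun t ht => hvanish t ?_
    by_contra! hcon
    exact ht.2 ⟨ht.1, hcon⟩

/-- The mixed integral of the indicator functions of `n` compact convex sets and of a bounded
upper semicontinuous concave function with maximum `M`. -/
theorem mixedIntegral_snoc_indicatorFn [NormedSpace ℝ E] [FiniteDimensional ℝ E] (μ : Measure E)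
    [μ.IsAddHaarMeasure] {n : ℕ} (hd : Module.finrank ℝ E = n) {Q : Fin n → Set E}
    (hQ : ∀ i, Convex ℝ (Q i)) (hQc : ∀ i, IsCompact (Q i)) (hQne : ∀ i, (Q i).Nonempty)
    (hclosed : ∀ t : ℝ, IsClosed {y | (t : EReal) ≤ g y})
    (hconv : ∀ t : ℝ, Convex ℝ {y | (t : EReal) ≤ g y})
    (hb : Bornology.IsBounded (effectiveDomain g)) {m M : ℝ}
    (hm : ∀ y ∈ effectiveDomain g, (m : EReal) ≤ g y) (hM : ∀ y, g y ≤ M)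
    (hmax : ∃ y, g y = M) :
    mixedIntegral μ (Fin.snoc (α := fun _ => E → EReal) (fun i => indicatorFn (Q i)) g) =
      mixedVolume μ Q * M := by
  obtain ⟨y₀, hy₀⟩ := hmax
  have hy₀dom : y₀ ∈ effectiveDomain g := by
    change g y₀ ≠ ⊥
    simp [hy₀]
  have hmM : m ≤ M := by
    have := hm y₀ hy₀dom
    rwa [hy₀, EReal.coe_le_coe_iff] at this
  have hdom : effectiveDomain g = {y | (m : EReal) ≤ g y} := by
    refine Set.Subset.antisymm hm fun y hy hbot => ?_
    rw [Set.mem_ofPred_eq, hbot] at hy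
    exact absurd hy (by simp)
  have hQTc : ∀ T : Finset (Fin n), IsCompact (∑ i ∈ T, Q i) := by
    intro T
    induction T using Finset.induction_on with
    | empty => simp
    | insert i T hi ih =>
      rw [Finset.sum_insert hi]
      exact (hQc i).add ih
  have key := fun T : Finset (Fin n) => integral_eq_of_superlevel μ (hQTc T) hclosed hb hm hM
    (fun t x => lt_supConvolution_snoc_iff hQne g T t x)
  have hMV := fun {K : Set E} => sum_neg_one_pow_mul_volume_sum_add μ hd Q hQ
    (fun i => (hQc i).isBounded) hQne (K := K)
  have hlast : ∀ T : Finset (Fin n), Fin.last n ∉ T.map Fin.castSuccEmb := fun T => by simp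
  -- The index sets split by whether they contain the last index, that of `g`; those without it sum
  -- to zero.
  rw [mixedIntegral, Finset.sum_filter, sum_finset_fin_succ, Finset.sum_eq_zero, zero_add]
  · have hterm : ∀ T : Finset (Fin n), (if (insert (Fin.last n) (T.map Fin.castSuccEmb)).Nonempty
        then (-1 : ℝ) ^ (n + 1 - (insert (Fin.last n) (T.map Fin.castSuccEmb)).card) *
          ∫ x in ∑ i ∈ insert (Fin.last n) (T.map Fin.castSuccEmb), effectiveDomain
            (Fin.snoc (α := fun _ => E → EReal) (fun i => indicatorFn (Q i)) g i),
            (supConvolution (insert (Fin.last n) (T.map Fin.castSuccEmb))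
              (Fin.snoc (α := fun _ => E → EReal) (fun i => indicatorFn (Q i)) g) x).toReal ∂μ
        else 0) = m * ((-1) ^ (n - T.card) * μ.real (∑ i ∈ T, Q i + effectiveDomain g)) +
          ∫ t in Set.Ioo 0 (M - m), (-1 : ℝ) ^ (n - T.card) *
            μ.real (∑ i ∈ T, Q i + {y | ((m + t : ℝ) : EReal) < g y}) := by
      intro T
      rw [if_pos (Finset.insert_nonempty _ _), Finset.card_insert_of_notMem (hlast T),
        Finset.card_map, Nat.add_sub_add_right, Finset.sum_insert (hlast T), Finset.sum_map]
      simp only [Fin.coe_castSuccEmb, Fin.snoc_castSucc, Fin.snoc_last,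
        effectiveDomain_indicatorFn]
      rw [add_comm (effectiveDomain g), (key T).2, integral_const_mul]
      ring
    rw [Finset.sum_congr rfl fun T _ => hterm T, Finset.sum_add_distrib, ← Finset.mul_sum,
      hMV (by rw [hdom]; exact hconv m) hb ⟨y₀, hy₀dom⟩,
      ← integral_finsetSum _ fun T _ => (key T).1.const_mul _,
      setIntegral_congr_fun (g := fun _ => mixedVolume μ Q) measurableSet_Ioo fun t ht => ?_,
      setIntegral_const, measureReal_def, Real.volume_Ioo,
      ENNReal.toReal_ofReal (by linarith), smul_eq_mul]
    · ring
    -- For `t < M - m` the maximizer `y₀` lies in the level set, so the alternating sum is the mixed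
    -- volume, independently of `t`.
    · refine hMV (convex_strict_superlevel hconv _) (hb.subset fun y hy => ne_bot_of_gt hy)
        ⟨y₀, ?_⟩
      rw [Set.mem_ofPred_eq, hy₀, EReal.coe_lt_coe_iff]
      linarith [ht.2]
  · intro T _
    split_ifs
    · rw [setIntegral_eq_zero_of_forall_eq_zero, mul_zero]
      intro x _
      refine toReal_supConvolution_indicatorFn _ _
        (Fin.snoc (α := fun _ => Set E) Q Set.univ) (fun i hi => ?_) x
      obtain ⟨j, -, rfl⟩ := Finset.mem_map.1 hi
      simp
    · rfl

end LayerCake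

end MixedIntegral

/-! ### The corollary, with `M = -f 0` -/

theorem corollary1p5 {V : Type*} [NormedAddCommGroup V] [NormedSpace ℝ V]
    [FiniteDimensional ℝ V] (N : Submodule ℤ V) [DiscreteTopology N] [IsZLattice ℝ N]
    (n : ℕ) (hn : Module.finrank ℤ N = n)
    (Q : Fin n → Set (StrongDual ℝ V))
    (hQ : ∀ i, MixedIntegral.IsRationalPolytope N (Q i)) (hQne : ∀ i, (Q i).Nonempty)
    (f : V → EReal) (hf : MixedIntegral.IsConcave f)
    (hstab : MixedIntegral.IsRationalPolytope N (MixedIntegral.stabilitySet f)) :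
    f 0 ≠ ⊥ ∧
      MixedIntegral.mixedIntegral (MixedIntegral.latticeVolume N)
          (Fin.snoc (α := fun _ => StrongDual ℝ V → EReal)
            (fun i => MixedIntegral.indicatorFn (Q i)) (MixedIntegral.legendreDual f)) =
        -(MixedIntegral.mixedVolume (MixedIntegral.latticeVolume N) Q) * (f 0).toReal := by
  have h0 := hf.ne_bot_of_isBounded_stabilitySet hstab.2 0
  refine ⟨h0, ?_⟩
  have hd : Module.finrank ℝ (StrongDual ℝ V) = n := by
    rw [← hn, ZLattice.rank ℝ N,
      ← (LinearMap.toContinuousLinearMap (𝕜 := ℝ) (E := V) (F' := ℝ)).finrank_eq]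
    exact Subspace.dual_finrank_eq
  have hH : (MixedIntegral.latticeVolume N).IsAddHaarMeasure := by
    unfold MixedIntegral.latticeVolume
    infer_instance
  obtain ⟨m, hm⟩ := MixedIntegral.exists_le_legendreDual hstab
  have hneg : -f 0 = ((-(f 0).toReal : ℝ) : EReal) := by
    rw [EReal.coe_neg, EReal.coe_toReal (hf.ne_top 0) h0]
  obtain ⟨x, hx⟩ := hf.exists_legendreDual_eq_neg hstab.2
  rw [MixedIntegral.mixedIntegral_snoc_indicatorFn (MixedIntegral.latticeVolume N) hd
    (fun i => (hQ i).1.convex) (fun i => (hQ i).isCompact) hQne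
    (MixedIntegral.isClosed_superlevel_legendreDual f)
    (MixedIntegral.convex_superlevel_legendreDual f) hstab.2 hm (M := -(f 0).toReal)
    (fun y => by
      rw [← hneg]
      simpa using MixedIntegral.legendreDual_le f y 0) ⟨x, hx.trans hneg⟩]
  ring
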